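/- Circuit model. Quantum circuits use the gates NOT, Hadamard, $T=\mathrm{diag}(1,e^{i\pi/4})$, CNOT, Toffoli, and three oracle gates acting on chosen $\ell$-qubit registers. Here $X\subseteq\{0,1\}^{\ell}$ is a non-empty search space. "Superposition access to $X$" means the gates $A$ and $A^{\dagger}$, where $A$ is some unitary on $\ell$ qubits with $A|0^{\ell}\rangle=|X|^{-1/2}\sum_{x\in X}|x\rangle$. The good subset $G=\{x\in X: f(x)=1\}$ is given by the gate $|x\rangle|b\rangle\mapsto|x\rangle|b\oplus f(x)\rangle$ for some function $f:\{0,1\}^{\ell}\to\{0,1\}$. The running time of a circuit is its number of gates, each oracle gate counting as one. Lemma. Let $\alpha\in\mathbb R$, let $q$ be a polynomial with natural number coefficients, and let $k\in\mathbb N$. There are a polynomial $p$ and a computable map that sends $(n,\ell,B,N)\in\mathbb N^4$ to a circuit $C_{n,\ell,B,N}$ such that the following holds for all $n,\ell,B\in\mathbb N$ with $B\ge 1$ and $\ell\le q(n)$, and for all $X\subseteq\{0,1\}^{\ell}$ of size $|X|=2^{\alpha n}$. The circuit $C=C_{n,\ell,B,|X|}$ runs in time at most $p(n)\,B\sqrt{|X|}$,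 that is, $\widetilde{O}(B\sqrt{|X|})$, and for every $A$ and $f$ as above, with $G=\{x\in X: f(x)=1\}$ (whose size is unknown to the algorithm): 1. (reversibility) for each $b\in\{0,1\}$, with $[\,|G|\ge B\,]\in\{0,1\}$ the truth value of $|G|\ge B$, $C$ maps $|b\rangle|0\cdots0\rangle$ to $|b\oplus[\,|G|\ge B\,]\rangle|0\cdots 0\rangle$ up to an error vector of norm at most $2^{-kn}$; 2. after running $C$ on $|0\rangle|0\cdots 0\rangle$, measuring the first qubit gives the truth value of $|G|\ge B$, except with probability at most $2^{-kn}$. In particular the error is exponentially small in $n$, with a bound that does not depend on $X$, $G$, $A$ and $f$. -/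

import Mathlib

namespace QCount

/-- Bit strings of length `l`, the encodings of the elements of a search space. -/
abbrev BitString (l : ℕ) : Type := Fin l → Bool

/-- Elementary gates; natural numbers are addresses of wires (qubits). The first five form a
universal gate set. The last three query the oracles; they act on the register made of the `l`
consecutive wires `s, s + 1, …, s + l - 1`. -/
inductive Gate : Type
  | not (i : ℕ)
  | had (i : ℕ)
  | phaseT (i : ℕ)
  | cnot (i t : ℕ)
  | toffoli (i j t : ℕ)
  | prep (s : ℕ)
  | prepInv (s : ℕ)
  | test (s t : ℕ)

/-- Gates as a sum of products of natural numbers, which makes lists of gates data on which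
Mathlib's notion of computability is available. -/
def Gate.equivSum :
    Gate ≃ ℕ ⊕ ℕ ⊕ ℕ ⊕ (ℕ × ℕ) ⊕ (ℕ × ℕ × ℕ) ⊕ ℕ ⊕ ℕ ⊕ (ℕ × ℕ) where
  toFun
    | .not i => .inl i
    | .had i => .inr (.inl i)
    | .phaseT i => .inr (.inr (.inl i))
    | .cnot i t => .inr (.inr (.inr (.inl (i, t))))
    | .toffoli i j t => .inr (.inr (.inr (.inr (.inl (i, j, t)))))
    | .prep s => .inr (.inr (.inr (.inr (.inr (.inl s)))))
    | .prepInv s => .inr (.inr (.inr (.inr (.inr (.inr (.inl s))))))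
    | .test s t => .inr (.inr (.inr (.inr (.inr (.inr (.inr (s, t)))))))
  invFun
    | .inl i => .not i
    | .inr (.inl i) => .had i
    | .inr (.inr (.inl i)) => .phaseT i
    | .inr (.inr (.inr (.inl (i, t)))) => .cnot i t
    | .inr (.inr (.inr (.inr (.inl (i, j, t))))) => .toffoli i j t
    | .inr (.inr (.inr (.inr (.inr (.inl s))))) => .prep s
    | .inr (.inr (.inr (.inr (.inr (.inr (.inl s)))))) => .prepInv s
    | .inr (.inr (.inr (.inr (.inr (.inr (.inr (s, t))))))) => .test s t
  left_inv g := by cases g <;> rfl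
  right_inv x := by rcases x with _ | _ | _ | _ | _ | _ | _ | _ <;> rfl

instance : Primcodable Gate := Primcodable.ofEquiv _ Gate.equivSum

/-- A quantum circuit: its number of wires and its gates, in the order of application. -/
structure Circuit : Type where
  width : ℕ
  gates : List Gate

def Circuit.equivProd : Circuit ≃ ℕ × List Gate where
  toFun C := (C.width, C.gates)
  invFun x := ⟨x.1, x.2⟩
  left_inv _ := rfl
  right_inv _ := rfl

instance : Primcodable Circuit := Primcodable.ofEquiv _ Circuit.equivProd

/-- The running time: the number of gates, where an oracle query counts as one gate. -/
def Circuit.time (C : Circuit) : ℕ := C.gates.length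

/-- The gate acts on existing and pairwise distinct wires of a circuit with `w` wires, when the
oracle registers have `l` wires. -/
def Gate.WellFormed (l w : ℕ) : Gate → Prop
  | .not i => i < w
  | .had i => i < w
  | .phaseT i => i < w
  | .cnot i t => i < w ∧ t < w ∧ i ≠ t
  | .toffoli i j t => i < w ∧ j < w ∧ t < w ∧ i ≠ j ∧ i ≠ t ∧ j ≠ t
  | .prep s => s + l ≤ w
  | .prepInv s => s + l ≤ w
  | .test s t => s + l ≤ w ∧ t < w ∧ (t < s ∨ s + l ≤ t)

/-- All gates are well formed, and the circuit has wire `0`, which receives the answer. -/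
def Circuit.WellFormed (l : ℕ) (C : Circuit) : Prop :=
  0 < C.width ∧ ∀ g ∈ C.gates, g.WellFormed l C.width

/-- Computational basis states of `w` wires. -/
abbrev Config (w : ℕ) : Type := Fin w → Bool

/-- The content of wire `i` (`false` if there is no such wire). -/
def Config.get {w : ℕ} (c : Config w) (i : ℕ) : Bool :=
  if h : i < w then c ⟨i, h⟩ else false

/-- Overwrite wire `i` by `b`. -/
def Config.put {w : ℕ} (c : Config w) (i : ℕ) (b : Bool) : Config w :=
  fun j => if (j : ℕ) = i then b else c j

/-- The content of the register of `l` wires that starts at `s`. -/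
def Config.getReg {w : ℕ} (l : ℕ) (c : Config w) (s : ℕ) : BitString l :=
  fun j => c.get (s + j)

/-- Overwrite the register of `l` wires that starts at `s` by `y`. -/
def Config.putReg {w l : ℕ} (c : Config w) (s : ℕ) (y : BitString l) : Config w :=
  fun j => if h : s ≤ (j : ℕ) ∧ (j : ℕ) < s + l then y ⟨(j : ℕ) - s, by omega⟩ else c j

/-- State vectors of `w` qubits, with the Hilbert space norm. -/
abbrev State (w : ℕ) : Type := EuclideanSpace ℂ (Config w)

/-- `A` is a unitary on `l` qubits that maps `|0…0⟩` to the uniform superposition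
`|X|^{-1/2} ∑_{x ∈ X} |x⟩` of the elements of `X`. -/
def Prepares {l : ℕ} (A : Matrix (BitString l) (BitString l) ℂ) (X : Finset (BitString l)) :
    Prop :=
  A ∈ Matrix.unitaryGroup (BitString l) ℂ ∧
    ∀ x, A x (fun _ => false) = if x ∈ X then ((1 / √(X.card : ℝ) : ℝ) : ℂ) else 0

/-- The action of a well-formed gate on a state, given by the amplitudes of the new state. The
gates `prep`, `prepInv`, `test` apply the unitary `A`, its inverse, and
`|x⟩|b⟩ ↦ |x⟩|b ⊕ f x⟩`. -/
noncomputable def Gate.apply {l : ℕ} (A : Matrix (BitString l) (BitString l) ℂ)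
    (f : BitString l → Bool) {w : ℕ} (g : Gate) (ψ : State w) : State w :=
  WithLp.toLp 2 fun c =>
    match g with
    | .not i => ψ (c.put i (!c.get i))
    | .had i =>
        (ψ (c.put i false) + (if c.get i then -1 else 1) * ψ (c.put i true)) / ((√2 : ℝ) : ℂ)
    | .phaseT i => (if c.get i then Complex.exp (Complex.I * (Real.pi / 4 : ℝ)) else 1) * ψ c
    | .cnot i t => ψ (c.put t (xor (c.get t) (c.get i)))
    | .toffoli i j t => ψ (c.put t (xor (c.get t) (c.get i && c.get j)))
    | .prep s => ∑ y : BitString l, A (c.getReg l s) y * ψ (c.putReg s y)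
    | .prepInv s => ∑ y : BitString l, A.conjTranspose (c.getReg l s) y * ψ (c.putReg s y)
    | .test s t => ψ (c.put t (xor (c.get t) (f (c.getReg l s))))

/-- The unitary computed by a circuit: apply its gates one after the other. -/
noncomputable def Circuit.run {l : ℕ} (A : Matrix (BitString l) (BitString l) ℂ)
    (f : BitString l → Bool) (C : Circuit) (ψ : State C.width) : State C.width :=
  C.gates.foldl (fun φ g => g.apply A f φ) ψ

/-- The basis state with `b` on wire `0` and `0` on all other wires. -/
noncomputable def answerKet (w : ℕ) (b : Bool) : State w :=
  EuclideanSpace.single (fun j : Fin w => if (j : ℕ) = 0 then b else false) 1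

/-- The probability that measuring wire `0` of `ψ` gives `b`. -/
noncomputable def probAnswer {w : ℕ} (ψ : State w) (b : Bool) : ℝ :=
  ∑ c : Config w, if c.get 0 = b then ‖ψ c‖ ^ 2 else 0

end QCount

/-! The circuit enumerates the good elements in increasing order of the numbers they encode. Once an
element `z` is found, the next one is determined by binary search over `l + 1` bits. Each bit is the
answer to a query: is there a good element beyond `z` and below `y`? Elements encode numbers below
`2 ^ l`, while a search that finds nothing ends with all `l + 1` bits set. So the top bit of the
`B`-th result is clear exactly when `|G| ≥ B`. This costs `B (l + 1)` queries.

A query is amplitude amplification with an unknown number of solutions. Let `sin² θ` be the fraction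
of `X` that satisfies the query. Starting from the preparation `A₀ = A`, the recursion `A_{i+1} =
A_i S A_i† D A_i`, with `D` and `S` the sign flips on solutions and on zero, triples the angle
(`exists_ampVec_eq`): level `i` leaves weight `cos² (3^i θ)` on non-solutions. If a solution exists,
then `θ ≥ |X|^(-1/2)`, so for `9 ^ μ ≥ |X|` some level `i ≤ μ` has its angle in `[π/6, π/2]` and
fails with probability at most `3/4` (`prod_sum_bad_le`). Running all levels in separate registers,
`5 e` times each, gives failure probability at most `(3/4)^(5e) ≤ 4^(-e)`. If there is no solution,
the answer is exact, since no amplitude ever leaves `X`. With `9 ^ μ < 9 |X|`, the cost is `3 ^ μ =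
O(√|X|)` up to factors polynomial in `n`.

Nothing is measured on the way. The correct answer of each query is determined by the classical
memory, so the state stays close to a basis state. Computing, copying the result by CNOT and
uncomputing costs at most twice the norm of the part with a wrong result
(`norm_compute_copy_uncompute`); by unitarity, the errors of successive steps add
(`norm_run_sub_trans`). Induction over bits (`exists_partial`) and over elements
(`exists_enumerated`) then leads to `norm_countGates_sub_le`, and `e = k n + 2 l + 2` suffices for
the total error. Computability holds because every list of gates is primitive recursive in its
parameters. -/

/-! ### Semantics of gates and of lists of gates -/

namespace QCount

/-! ### Memories and configurations -/

/-- The restriction of an infinite memory to the first `w` wires. -/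
def cfg (w : ℕ) (m : ℕ → Bool) : Config w := fun j => m j

/-- The register of `l` wires that starts at `s`. -/
def reg (l : ℕ) (m : ℕ → Bool) (s : ℕ) : BitString l := fun j => m (s + j)

/-- Overwrite the register of `l` wires that starts at `s`. -/
def setReg {l : ℕ} (m : ℕ → Bool) (s : ℕ) (x : BitString l) : ℕ → Bool :=
  fun i => if h : s ≤ i ∧ i < s + l then x ⟨i - s, by omega⟩ else m i

/-- The basis state given by a memory. -/
noncomputable def ket (w : ℕ) (m : ℕ → Bool) : State w := EuclideanSpace.single (cfg w m) 1

theorem ket_apply (w : ℕ) (m : ℕ → Bool) (c : Config w) :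
    ket w m c = if c = cfg w m then 1 else 0 := by
  simp [ket]

theorem cfg_get {w : ℕ} (c : Config w) : cfg w c.get = c := by
  funext j
  simp [cfg, Config.get]

theorem get_cfg {w i : ℕ} (m : ℕ → Bool) (h : i < w) : (cfg w m).get i = m i := by
  simp [cfg, Config.get, h]

theorem cfg_congr {w : ℕ} {m m' : ℕ → Bool} (h : ∀ i < w, m i = m' i) : cfg w m = cfg w m' :=
  funext fun j => h j j.2

theorem put_eq {w : ℕ} (c : Config w) (i : ℕ) (b : Bool) :
    c.put i b = cfg w (Function.update c.get i b) := by
  funext j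
  by_cases h : (j : ℕ) = i <;> simp [Config.put, cfg, Function.update, Config.get, h]

theorem putReg_eq {w l : ℕ} (c : Config w) (s : ℕ) (y : BitString l) :
    c.putReg s y = cfg w (setReg c.get s y) := by
  funext j
  by_cases h : s ≤ (j : ℕ) ∧ (j : ℕ) < s + l <;>
    simp [Config.putReg, cfg, setReg, Config.get, h]

theorem get_put {w : ℕ} (c : Config w) {i : ℕ} (hi : i < w) (b : Bool) (j : ℕ) :
    (c.put i b).get j = if j = i then b else c.get j := by
  by_cases h : j < w
  · simp [Config.get, Config.put, h]
  · have : j ≠ i := by omega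
    simp [Config.get, h, this]

theorem put_get {w : ℕ} (c : Config w) (i : ℕ) : c.put i (c.get i) = c := by
  rw [put_eq, Function.update_eq_self, cfg_get]

theorem put_put {w : ℕ} (c : Config w) (i : ℕ) (a b : Bool) : (c.put i a).put i b = c.put i b := by
  funext j
  by_cases h : (j : ℕ) = i <;> simp [Config.put, h]

theorem put_comm {w : ℕ} (c : Config w) {i j : ℕ} (h : i ≠ j) (a b : Bool) :
    (c.put i a).put j b = (c.put j b).put i a := by
  funext k
  by_cases h1 : (k : ℕ) = i <;> by_cases h2 : (k : ℕ) = j <;> simp [Config.put, h1, h2] <;> omega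

theorem reg_setReg {l : ℕ} (m : ℕ → Bool) (s : ℕ) (x : BitString l) :
    reg l (setReg m s x) s = x := by
  funext j
  simp [reg, setReg]

theorem setReg_of_lt {l : ℕ} (m : ℕ → Bool) (s : ℕ) (x : BitString l) {i : ℕ}
    (h : i < s ∨ s + l ≤ i) : setReg m s x i = m i := by
  rw [setReg, dif_neg (by omega)]

theorem setReg_reg (l : ℕ) (m : ℕ → Bool) (s : ℕ) : setReg m s (reg l m s) = m := by
  funext i
  by_cases h : s ≤ i ∧ i < s + l
  · simp only [setReg, dif_pos h, reg]
    congr 1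
    omega
  · simp only [setReg, dif_neg h]

theorem getReg_putReg {w l : ℕ} (c : Config w) {s : ℕ} (hs : s + l ≤ w) (y : BitString l) :
    (c.putReg s y).getReg l s = y := by
  funext j
  have : s + (j : ℕ) < w := by omega
  simp [Config.getReg, Config.get, Config.putReg, this]

theorem putReg_putReg {w l : ℕ} (c : Config w) (s : ℕ) (x y : BitString l) :
    (c.putReg s x).putReg s y = c.putReg s y := by
  funext i
  by_cases h : s ≤ (i : ℕ) ∧ (i : ℕ) < s + l <;> simp [Config.putReg, h]

theorem putReg_getReg {w : ℕ} (l : ℕ) (c : Config w) (s : ℕ) :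
    c.putReg s (c.getReg l s) = c := by
  rw [putReg_eq]
  change cfg w (setReg c.get s (reg l c.get s)) = c
  rw [setReg_reg, cfg_get]

theorem putReg_put {w l : ℕ} (c : Config w) {s t : ℕ} (h : t < s ∨ s + l ≤ t) (b : Bool)
    (y : BitString l) : (c.put t b).putReg s y = (c.putReg s y).put t b := by
  funext i
  by_cases h1 : s ≤ (i : ℕ) ∧ (i : ℕ) < s + l
  · have : (i : ℕ) ≠ t := by omega
    simp [Config.putReg, Config.put, h1, this]
  · by_cases h2 : (i : ℕ) = t
    · have : ¬ (s ≤ t ∧ t < s + l) := by omega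
      simp [Config.putReg, Config.put, h2, this]
    · simp [Config.putReg, Config.put, h1, h2]

theorem getReg_put {w l : ℕ} (c : Config w) {s t : ℕ} (h : t < s ∨ s + l ≤ t) (b : Bool) :
    (c.put t b).getReg l s = c.getReg l s := by
  funext j
  have : s + (j : ℕ) ≠ t := by omega
  simp [Config.getReg, Config.get, Config.put, this]

theorem get_putReg {w l : ℕ} (c : Config w) {s t : ℕ} (h : t < s ∨ s + l ≤ t)
    (y : BitString l) : (c.putReg s y).get t = c.get t := by
  have : ¬ (s ≤ t ∧ t < s + l) := by omega
  simp [Config.get, Config.putReg, this]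

/-! ### Gates on memories -/

/-- The gate is not `phaseT` and acts on pairwise distinct wires which all satisfy `P`. -/
def Gate.On (l : ℕ) (P : ℕ → Prop) : Gate → Prop
  | .not i => P i
  | .had i => P i
  | .phaseT _ => False
  | .cnot i t => P i ∧ P t ∧ i ≠ t
  | .toffoli i j t => P i ∧ P j ∧ P t ∧ i ≠ j ∧ i ≠ t ∧ j ≠ t
  -- The index `j = l` is included so that `s + l ≤ w` follows from `P = (· < w)` even when `l = 0`.
  -- Search registers have a padding wire there.
  | .prep s => ∀ j ≤ l, P (s + j)
  | .prepInv s => ∀ j ≤ l, P (s + j)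
  | .test s t => (∀ j ≤ l, P (s + j)) ∧ P t ∧ (t < s ∨ s + l ≤ t)

theorem Gate.On.mono {l : ℕ} {P Q : ℕ → Prop} (h : ∀ i, P i → Q i) {g : Gate} (hg : g.On l P) :
    g.On l Q := by
  cases g <;> simp only [Gate.On] at hg ⊢ <;> grind

theorem Gate.On.wellFormed {l w : ℕ} {g : Gate} (hg : g.On l (· < w)) : g.WellFormed l w := by
  cases g with
  | not | had | cnot | toffoli => exact hg
  | phaseT => exact hg.elim
  | prep | prepInv => exact (hg l le_rfl).le
  | test => exact ⟨(hg.1 l le_rfl).le, hg.2⟩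

/-- The gates that permute the basis states. -/
def Gate.Classical : Gate → Prop
  | .not _ => True
  | .cnot _ _ => True
  | .toffoli _ _ _ => True
  | .test _ _ => True
  | _ => False

/-- The action of the classical gates on memories. -/
def Gate.act {l : ℕ} (f : BitString l → Bool) (g : Gate) (m : ℕ → Bool) : ℕ → Bool :=
  match g with
  | .not i => Function.update m i (!m i)
  | .cnot i t => Function.update m t (xor (m t) (m i))
  | .toffoli i j t => Function.update m t (xor (m t) (m i && m j))
  | .test s t => Function.update m t (xor (m t) (f (reg l m s)))
  | _ => m

/-- The inverse gate of a gate other than `phaseT`. -/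
def Gate.inv : Gate → Gate
  | .prep s => .prepInv s
  | .prepInv s => .prep s
  | g => g

theorem Gate.On.inv {l : ℕ} {P : ℕ → Prop} {g : Gate} (hg : g.On l P) : g.inv.On l P := by
  cases g <;> exact hg

theorem Gate.Classical.inv_eq {g : Gate} (hg : g.Classical) : g.inv = g := by
  cases g <;> first | rfl | exact hg.elim

section

variable {l : ℕ} (f : BitString l → Bool)

theorem Gate.On.act_congr {P : ℕ → Prop} {g : Gate} (hg : g.On l P) {m m' : ℕ → Bool}
    (h : ∀ i, P i → m i = m' i) {i : ℕ} (hi : m i = m' i) : g.act f m i = g.act f m' i := by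
  cases g with
  | not j => simp only [Gate.On] at hg; simp [Gate.act, Function.update_apply, hi, h j hg]
  | cnot j t =>
    obtain ⟨h1, h2, h3⟩ := hg
    simp [Gate.act, Function.update_apply, hi, h j h1, h t h2]
  | toffoli j k t =>
    obtain ⟨h1, h2, h3, -⟩ := hg
    simp [Gate.act, Function.update_apply, hi, h j h1, h t h3, h k h2]
  | test s t =>
    obtain ⟨h1, h2, h3⟩ := hg
    have : reg l m s = reg l m' s := funext fun j => h _ (h1 j j.2.le)
    simp [Gate.act, Function.update_apply, hi, this, h t h2]
  | had | phaseT | prep | prepInv => exact hi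

theorem Gate.On.act_of_not {P : ℕ → Prop} {g : Gate} (hg : g.On l P) (m : ℕ → Bool)
    {i : ℕ} (hi : ¬ P i) : g.act f m i = m i := by
  cases g with
  | not j =>
    simp only [Gate.On] at hg
    exact Function.update_of_ne (by rintro rfl; exact hi hg) _ _
  | cnot j t => exact Function.update_of_ne (by rintro rfl; exact hi hg.2.1) _ _
  | toffoli j k t => exact Function.update_of_ne (by rintro rfl; exact hi hg.2.2.1) _ _
  | test s t => exact Function.update_of_ne (by rintro rfl; exact hi hg.2.1) _ _
  | had | phaseT | prep | prepInv => rfl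

theorem Gate.On.act_update {P : ℕ → Prop} {g : Gate} (hg : g.On l P) (m : ℕ → Bool)
    {t : ℕ} (ht : ¬ P t) (b : Bool) :
    g.act f (Function.update m t b) = Function.update (g.act f m) t b := by
  funext i
  by_cases hi : i = t
  · subst hi
    rw [hg.act_of_not f _ ht, Function.update_self, Function.update_self]
  · rw [Function.update_of_ne hi]
    refine hg.act_congr f (fun j hj => ?_) (Function.update_of_ne hi _ _)
    exact Function.update_of_ne (by rintro rfl; exact ht hj) _ _

theorem Gate.On.act_act {P : ℕ → Prop} {g : Gate} (hg : g.On l P) (m : ℕ → Bool) :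
    g.act f (g.act f m) = m := by
  cases g with
  | not j => simp [Gate.act]
  | cnot j t =>
    obtain ⟨h1, h2, h3⟩ := hg
    simp [Gate.act, Function.update_of_ne h3]
  | toffoli j k t =>
    obtain ⟨h1, h2, h3, h4, h5, h6⟩ := hg
    simp [Gate.act, Function.update_of_ne h5, Function.update_of_ne h6]
  | test s t =>
    obtain ⟨h1, h2, h3⟩ := hg
    have : ∀ b, reg l (Function.update m t b) s = reg l m s := fun b =>
      funext fun j => Function.update_of_ne (by omega) _ _
    simp [Gate.act, this]
  | had | phaseT | prep | prepInv => rfl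

/-! ### Gates on states -/

variable (A : Matrix (BitString l) (BitString l) ℂ) {w : ℕ}

theorem Gate.Classical.apply_eq {g : Gate} (hg : g.Classical) (ψ : State w) (c : Config w) :
    g.apply A f ψ c = ψ (cfg w (g.act f c.get)) := by
  cases g with
  | not | cnot | toffoli => simp only [Gate.apply, put_eq]; rfl
  | test s t => simp only [Gate.apply, put_eq]; rfl
  | had | phaseT | prep | prepInv => exact hg.elim

theorem Gate.On.cfg_act {g : Gate} (hg : g.On l (· < w)) (m : ℕ → Bool) :
    cfg w (g.act f (cfg w m).get) = cfg w (g.act f m) :=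
  cfg_congr fun _ hi => hg.act_congr f (fun _ hj => get_cfg m hj) (get_cfg m hi)

theorem Gate.On.cfg_act_involutive {g : Gate} (hg : g.On l (· < w)) :
    Function.Involutive fun c : Config w => cfg w (g.act f c.get) := by
  intro c
  change cfg w (g.act f (cfg w (g.act f c.get)).get) = c
  rw [hg.cfg_act, hg.act_act, cfg_get]

theorem Gate.Classical.apply_ket {g : Gate} (hg : g.Classical) (hw : g.On l (· < w))
    (m : ℕ → Bool) : g.apply A f (ket w m) = ket w (g.act f m) := by
  ext c
  rw [hg.apply_eq, ket_apply, ket_apply, ← hw.cfg_act f m]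
  congr 1
  rw [eq_iff_iff]
  constructor
  · rintro h
    rw [← h]
    exact (hw.cfg_act_involutive f c).symm
  · rintro rfl
    exact hw.cfg_act_involutive f (cfg w m)

theorem Gate.apply_add (g : Gate) (ψ φ : State w) :
    g.apply A f (ψ + φ) = g.apply A f ψ + g.apply A f φ := by
  ext c
  cases g <;> simp only [Gate.apply, PiLp.add_apply, mul_add, Finset.sum_add_distrib]
  ring

theorem Gate.apply_smul (g : Gate) (a : ℂ) (ψ : State w) :
    g.apply A f (a • ψ) = a • g.apply A f ψ := by
  ext c
  cases g <;> simp only [Gate.apply, PiLp.smul_apply, smul_eq_mul, Finset.mul_sum] <;>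
    first | (refine Finset.sum_congr rfl fun y _ => ?_; ring) | ring

/-- Exchanging `y` with the content of the register is an involution on pairs `(c, y)`. This splits
the norm of a state into norms of `l`-qubit vectors, one for each `c`, to which the unitarity of `A`
applies. -/
theorem sum_putReg_getReg {s : ℕ} (hs : s + l ≤ w) (F : Config w → ℝ) :
    ∑ c : Config w, ∑ y : BitString l, F (c.putReg s y) = 2 ^ l * ∑ c, F c := by
  have h : Function.Involutive fun p : Config w × BitString l =>
      (p.1.putReg s p.2, p.1.getReg l s) := by
    rintro ⟨c, y⟩
    simp [getReg_putReg c hs, putReg_putReg, putReg_getReg]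
  have h2 := Equiv.sum_comp h.toPerm fun p : Config w × BitString l => F p.1
  simp only [Function.Involutive.coe_toPerm, Fintype.sum_prod_type] at h2
  rw [h2]
  simp [Finset.mul_sum]

theorem norm_sq_mulVec (hA : A ∈ Matrix.unitaryGroup (BitString l) ℂ) (v : BitString l → ℂ) :
    ∑ x, ‖(A.mulVec v) x‖ ^ 2 = ∑ x, ‖v x‖ ^ 2 := by
  have key : ∀ u : BitString l → ℂ, ((∑ x, ‖u x‖ ^ 2 : ℝ) : ℂ) = star u ⬝ᵥ u := by
    intro u
    simp only [dotProduct, Pi.star_apply, RCLike.star_def, Complex.conj_mul']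
    push_cast
    rfl
  have : ((∑ x, ‖(A.mulVec v) x‖ ^ 2 : ℝ) : ℂ) = ((∑ x, ‖v x‖ ^ 2 : ℝ) : ℂ) := by
    rw [key, key, Matrix.star_mulVec, ← Matrix.dotProduct_mulVec, Matrix.mulVec_mulVec,
      ← Matrix.star_eq_conjTranspose, Matrix.mem_unitaryGroup_iff'.1 hA, Matrix.one_mulVec]
  exact_mod_cast this

theorem norm_prep {s : ℕ} (hs : s + l ≤ w) (hA : A ∈ Matrix.unitaryGroup (BitString l) ℂ)
    (ψ : State w) : ‖(Gate.prep s).apply A f ψ‖ = ‖ψ‖ := by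
  have h : ‖(Gate.prep s).apply A f ψ‖ ^ 2 = ‖ψ‖ ^ 2 := by
    rw [EuclideanSpace.norm_sq_eq, EuclideanSpace.norm_sq_eq]
    have h2 : (2 : ℝ) ^ l ≠ 0 := by positivity
    apply mul_left_cancel₀ h2
    rw [← sum_putReg_getReg hs, ← sum_putReg_getReg hs]
    refine Finset.sum_congr rfl fun c _ => ?_
    rw [← norm_sq_mulVec A hA fun y => ψ (c.putReg s y)]
    refine Finset.sum_congr rfl fun x _ => ?_
    simp only [Gate.apply, getReg_putReg c hs, putReg_putReg]
    rfl
  exact (pow_left_inj₀ (norm_nonneg _) (norm_nonneg _) two_ne_zero).1 h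

theorem norm_had {i : ℕ} (hi : i < w) (ψ : State w) :
    ‖(Gate.had i).apply A f ψ‖ = ‖ψ‖ := by
  have hflip : Function.Involutive fun c : Config w => c.put i (!c.get i) := by
    intro c
    simp [get_put c hi, put_put, put_get]
  -- Each configuration is paired with its flip at wire `i`; on each pair the claim is the
  -- parallelogram law.
  have h2 : ∀ F : Config w → ℝ, 2 * ∑ c, F c = ∑ c, (F c + F (c.put i (!c.get i))) := by
    intro F
    have h := Equiv.sum_comp hflip.toPerm F
    simp only [Function.Involutive.coe_toPerm] at h
    rw [Finset.sum_add_distrib, h, two_mul]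
  have h : ‖(Gate.had i).apply A f ψ‖ ^ 2 = ‖ψ‖ ^ 2 := by
    rw [EuclideanSpace.norm_sq_eq, EuclideanSpace.norm_sq_eq]
    apply mul_left_cancel₀ (two_ne_zero (α := ℝ))
    rw [h2, h2]
    refine Finset.sum_congr rfl fun c _ => ?_
    have e : ∀ a b : ℂ, ‖(a + b) / ((√2 : ℝ) : ℂ)‖ ^ 2 + ‖(a + -1 * b) / ((√2 : ℝ) : ℂ)‖ ^ 2
        = ‖a‖ ^ 2 + ‖b‖ ^ 2 := by
      intro a b
      have hp := parallelogram_law_with_norm ℝ a b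
      have h3 : ‖((√2 : ℝ) : ℂ)‖ ^ 2 = 2 := by simp
      rw [norm_div, norm_div, div_pow, div_pow, h3, neg_one_mul, ← sub_eq_add_neg]
      nlinarith
    have e1 := e (ψ (c.put i false)) (ψ (c.put i true))
    have hc := put_get c i
    cases hb : c.get i <;> rw [hb] at hc <;>
      simp [Gate.apply, get_put c hi, put_put, hb] at e1 ⊢ <;> rw [hc] at e1 ⊢ <;> linarith
  exact (pow_left_inj₀ (norm_nonneg _) (norm_nonneg _) two_ne_zero).1 h

theorem norm_classical {g : Gate} (hg : g.Classical) (hw : g.On l (· < w)) (ψ : State w) :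
    ‖g.apply A f ψ‖ = ‖ψ‖ := by
  rw [EuclideanSpace.norm_eq, EuclideanSpace.norm_eq]
  simp only [hg.apply_eq f A]
  have h := Equiv.sum_comp (hw.cfg_act_involutive f).toPerm fun c => ‖ψ c‖ ^ 2
  simp only [Function.Involutive.coe_toPerm] at h
  rw [h]

theorem Gate.On.norm_apply (hA : A ∈ Matrix.unitaryGroup (BitString l) ℂ) {g : Gate}
    (hg : g.On l (· < w)) (ψ : State w) : ‖g.apply A f ψ‖ = ‖ψ‖ := by
  cases g with
  | not | cnot | toffoli | test => exact norm_classical f A (by exact trivial) hg ψ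
  | had i => exact norm_had f A hg ψ
  | phaseT => exact hg.elim
  | prep s => exact norm_prep f A (hg l le_rfl).le hA ψ
  | prepInv s =>
    exact norm_prep f A.conjTranspose (hg l le_rfl).le
      (Matrix.star_eq_conjTranspose A ▸ Unitary.star_mem hA) ψ

theorem prepInv_prep (hA : A.conjTranspose * A = 1) {s : ℕ} (hs : s + l ≤ w) (ψ : State w) :
    (Gate.prepInv s).apply A f ((Gate.prep s).apply A f ψ) = ψ := by
  ext c
  simp only [Gate.apply, getReg_putReg c hs, putReg_putReg]
  have : (A.conjTranspose.mulVec (A.mulVec fun y => ψ (c.putReg s y))) (c.getReg l s) = ψ c := by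
    rw [Matrix.mulVec_mulVec, hA, Matrix.one_mulVec, putReg_getReg]
  rw [← this]
  rfl

theorem Gate.On.apply_inv_apply (hA : A ∈ Matrix.unitaryGroup (BitString l) ℂ) {g : Gate}
    (hg : g.On l (· < w)) (ψ : State w) : g.inv.apply A f (g.apply A f ψ) = ψ := by
  have classical : ∀ g : Gate, g.Classical → g.On l (· < w) →
      g.inv.apply A f (g.apply A f ψ) = ψ := by
    intro g h hw
    ext c
    rw [h.inv_eq, h.apply_eq, h.apply_eq]
    exact congrArg ψ.ofLp (hw.cfg_act_involutive f c)
  cases g with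
  | not | cnot | toffoli | test => exact classical _ (by exact trivial) hg
  | had i =>
    have hi : i < w := hg
    ext c
    have h3 : ((√2 : ℝ) : ℂ) ≠ 0 := by simp
    have h4 : ((√2 : ℝ) : ℂ) ^ 2 = 2 := by
      rw [← Complex.ofReal_pow, Real.sq_sqrt (by norm_num)]
      norm_num
    have hc := put_get c i
    cases hb : c.get i <;> rw [hb] at hc <;>
      simp [Gate.apply, Gate.inv, get_put c hi, put_put, hb] <;> rw [hc] <;> field_simp <;>
      rw [h4] <;> ring
  | phaseT => exact hg.elim
  | prep s =>
    exact prepInv_prep f A (Matrix.star_eq_conjTranspose A ▸ Matrix.mem_unitaryGroup_iff'.1 hA)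
      (hg l le_rfl).le ψ
  | prepInv s =>
    have := prepInv_prep f A.conjTranspose (w := w) (s := s)
      (by rw [Matrix.conjTranspose_conjTranspose]; exact Matrix.mem_unitaryGroup_iff.1 hA)
      (hg l le_rfl).le ψ
    simpa only [Gate.apply, Gate.inv, Matrix.conjTranspose_conjTranspose] using this

/-- A gate that avoids wire `t` neither reads nor writes it. This lets a NOT on the target of a copy
pass through the uncomputation. -/
theorem Gate.On.apply_not {P : ℕ → Prop} {g : Gate} (hg : g.On l P) (hP : ∀ i, P i → i < w)
    {t : ℕ} (ht : ¬ P t) (ψ : State w) :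
    g.apply A f ((Gate.not t).apply A f ψ) = (Gate.not t).apply A f (g.apply A f ψ) := by
  by_cases htw : t < w
  swap
  · have : ∀ ψ : State w, (Gate.not t).apply A f ψ = ψ := by
      intro ψ
      ext c
      simp only [Gate.apply]
      refine congrArg ψ.ofLp (funext fun j => ?_)
      have : (j : ℕ) ≠ t := by omega
      simp [Config.put, this]
    rw [this, this]
  have hgw := hg.mono hP
  have hnot : (Gate.not t).On l (· < w) := htw
  have hreg : ∀ s, (∀ j ≤ l, P (s + j)) → t < s ∨ s + l ≤ t := by
    intro s hs
    by_contra! h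
    exact ht (by simpa [h.1] using hs (t - s) (by omega))
  have classical : ∀ g : Gate, g.Classical → g.On l P → g.On l (· < w) →
      g.apply A f ((Gate.not t).apply A f ψ) = (Gate.not t).apply A f (g.apply A f ψ) := by
    intro g h hp hw
    ext c
    rw [h.apply_eq, Gate.Classical.apply_eq f A (g := .not t) trivial,
      Gate.Classical.apply_eq f A (g := .not t) trivial, h.apply_eq, hnot.cfg_act, hw.cfg_act]
    refine congrArg (fun m => ψ.ofLp (cfg w m)) ?_
    change Function.update (g.act f c.get) t (!g.act f c.get t) =
      g.act f (Function.update c.get t (!c.get t))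
    rw [hp.act_update f _ ht, hp.act_of_not f _ ht]
  cases g with
  | not | cnot | toffoli | test => exact classical _ (by exact trivial) hg hgw
  | had i =>
    have hi : i < w := hP i hg
    have hit : i ≠ t := by rintro rfl; exact ht hg
    ext c
    simp only [Gate.apply, get_put c hi, get_put c htw, if_neg hit, if_neg hit.symm]
    rw [put_comm c hit, put_comm c hit]
  | phaseT => exact hg.elim
  | prep s | prepInv s =>
    ext c
    have h := hreg s hg
    simp only [Gate.apply, getReg_put c h, putReg_put c h, get_putReg c h]

/-! ### Lists of gates -/

/-- The linear map computed by a list of gates. -/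
noncomputable def run (w : ℕ) (gs : List Gate) : State w →ₗ[ℂ] State w where
  toFun ψ := gs.foldl (fun φ g => g.apply A f φ) ψ
  map_add' ψ φ := by
    induction gs generalizing ψ φ with
    | nil => rfl
    | cons g gs ih => simp only [List.foldl_cons, Gate.apply_add, ih]
  map_smul' a ψ := by
    induction gs generalizing ψ with
    | nil => rfl
    | cons g gs ih =>
      simp only [List.foldl_cons, Gate.apply_smul, ih]

/-- The action of a list of classical gates on memories. -/
def acts (gs : List Gate) (m : ℕ → Bool) : ℕ → Bool := gs.foldl (fun m g => g.act f m) m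

@[simp] theorem run_nil (ψ : State w) : run f A w [] ψ = ψ := rfl

theorem run_cons (g : Gate) (gs : List Gate) (ψ : State w) :
    run f A w (g :: gs) ψ = run f A w gs (g.apply A f ψ) := rfl

theorem run_append (gs hs : List Gate) (ψ : State w) :
    run f A w (gs ++ hs) ψ = run f A w hs (run f A w gs ψ) := List.foldl_append

@[simp] theorem acts_nil (m : ℕ → Bool) : acts f [] m = m := rfl

@[simp] theorem acts_cons (g : Gate) (gs : List Gate) (m : ℕ → Bool) :
    acts f (g :: gs) m = acts f gs (g.act f m) := rfl

theorem acts_append (gs hs : List Gate) (m : ℕ → Bool) :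
    acts f (gs ++ hs) m = acts f hs (acts f gs m) := List.foldl_append

end

/-- The gates of the list act on pairwise distinct wires which all satisfy `P`. -/
def ListOn (l : ℕ) (P : ℕ → Prop) (gs : List Gate) : Prop := ∀ g ∈ gs, g.On l P

/-- All gates of the list permute the basis states. -/
def ListClassical (gs : List Gate) : Prop := ∀ g ∈ gs, g.Classical

/-- The inverse list of gates. -/
def invList (gs : List Gate) : List Gate := (gs.map Gate.inv).reverse

theorem length_invList (gs : List Gate) : (invList gs).length = gs.length := by
  simp [invList]

theorem ListOn.mono {l : ℕ} {P Q : ℕ → Prop} (h : ∀ i, P i → Q i) {gs : List Gate}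
    (hg : ListOn l P gs) : ListOn l Q gs := fun g hm => (hg g hm).mono h

theorem ListOn.inv {l : ℕ} {P : ℕ → Prop} {gs : List Gate} (hg : ListOn l P gs) :
    ListOn l P (invList gs) := by
  intro g hm
  simp only [invList, List.mem_reverse, List.mem_map] at hm
  obtain ⟨g', h, rfl⟩ := hm
  exact (hg g' h).inv

theorem ListOn.reverse {l : ℕ} {P : ℕ → Prop} {gs : List Gate} (hg : ListOn l P gs) :
    ListOn l P gs.reverse := fun g hm => hg g (List.mem_reverse.1 hm)

theorem ListClassical.reverse {gs : List Gate} (hg : ListClassical gs) :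
    ListClassical gs.reverse := fun g hm => hg g (List.mem_reverse.1 hm)

@[simp] theorem listOn_nil {l : ℕ} {P : ℕ → Prop} : ListOn l P [] := by
  simp [ListOn]

@[simp] theorem listOn_cons {l : ℕ} {P : ℕ → Prop} {g : Gate} {gs : List Gate} :
    ListOn l P (g :: gs) ↔ g.On l P ∧ ListOn l P gs := by
  simp [ListOn]

@[simp] theorem listOn_append {l : ℕ} {P : ℕ → Prop} {gs hs : List Gate} :
    ListOn l P (gs ++ hs) ↔ ListOn l P gs ∧ ListOn l P hs := by
  simp [ListOn, or_imp, forall_and]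

theorem listOn_flatMap {α : Type*} {l : ℕ} {P : ℕ → Prop} {as : List α} {F : α → List Gate} :
    ListOn l P (as.flatMap F) ↔ ∀ a ∈ as, ListOn l P (F a) := by
  simp only [ListOn, List.mem_flatMap]
  grind

@[simp] theorem listClassical_nil : ListClassical [] := by
  simp [ListClassical]

@[simp] theorem listClassical_cons {g : Gate} {gs : List Gate} :
    ListClassical (g :: gs) ↔ g.Classical ∧ ListClassical gs := by
  simp [ListClassical]

@[simp] theorem listClassical_append {gs hs : List Gate} :
    ListClassical (gs ++ hs) ↔ ListClassical gs ∧ ListClassical hs := by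
  simp [ListClassical, or_imp, forall_and]

theorem listClassical_flatMap {α : Type*} {as : List α} {F : α → List Gate} :
    ListClassical (as.flatMap F) ↔ ∀ a ∈ as, ListClassical (F a) := by
  simp only [ListClassical, List.mem_flatMap]
  grind

section

variable {l : ℕ} (f : BitString l → Bool) (A : Matrix (BitString l) (BitString l) ℂ) {w : ℕ}

theorem ListClassical.run_ket {gs : List Gate} (hc : ListClassical gs)
    (hw : ListOn l (· < w) gs) (m : ℕ → Bool) :
    run f A w gs (ket w m) = ket w (acts f gs m) := by
  induction gs generalizing m with
  | nil => rfl
  | cons g gs ih =>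
    simp only [listClassical_cons, listOn_cons] at hc hw
    rw [run_cons, hc.1.apply_ket f A hw.1, ih hc.2 hw.2, acts_cons]

theorem ListOn.acts_reverse {P : ℕ → Prop} {gs : List Gate} (hg : ListOn l P gs)
    (m : ℕ → Bool) : acts f gs.reverse (acts f gs m) = m := by
  induction gs generalizing m with
  | nil => rfl
  | cons g gs ih =>
    simp only [listOn_cons] at hg
    rw [acts_cons, List.reverse_cons, acts_append, ih hg.2]
    exact hg.1.act_act f m

theorem ListOn.acts_update {P : ℕ → Prop} {gs : List Gate} (hg : ListOn l P gs)
    (m : ℕ → Bool) {t : ℕ} (ht : ¬ P t) (b : Bool) :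
    acts f gs (Function.update m t b) = Function.update (acts f gs m) t b := by
  induction gs generalizing m with
  | nil => rfl
  | cons g gs ih =>
    simp only [listOn_cons] at hg
    rw [acts_cons, hg.1.act_update f m ht, ih hg.2, acts_cons]

theorem ListOn.acts_of_not {P : ℕ → Prop} {gs : List Gate} (hg : ListOn l P gs)
    (m : ℕ → Bool) {t : ℕ} (ht : ¬ P t) : acts f gs m t = m t := by
  induction gs generalizing m with
  | nil => rfl
  | cons g gs ih =>
    simp only [listOn_cons] at hg
    rw [acts_cons, ih hg.2, hg.1.act_of_not f m ht]

variable {A}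

theorem ListOn.norm_run (hA : A ∈ Matrix.unitaryGroup (BitString l) ℂ) {gs : List Gate}
    (hg : ListOn l (· < w) gs) (ψ : State w) : ‖run f A w gs ψ‖ = ‖ψ‖ := by
  induction gs generalizing ψ with
  | nil => rfl
  | cons g gs ih =>
    simp only [listOn_cons] at hg
    rw [run_cons, ih hg.2, hg.1.norm_apply f A hA]

theorem ListOn.run_inv_run (hA : A ∈ Matrix.unitaryGroup (BitString l) ℂ) {gs : List Gate}
    (hg : ListOn l (· < w) gs) (ψ : State w) :
    run f A w (invList gs) (run f A w gs ψ) = ψ := by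
  induction gs generalizing ψ with
  | nil => rfl
  | cons g gs ih =>
    simp only [listOn_cons] at hg
    have : invList (g :: gs) = invList gs ++ [g.inv] := by simp [invList]
    rw [run_cons, this, run_append, ih hg.2]
    exact hg.1.apply_inv_apply f A hA ψ

theorem ListOn.run_not {P : ℕ → Prop} {gs : List Gate} (hg : ListOn l P gs)
    (hP : ∀ i, P i → i < w) {t : ℕ} (ht : ¬ P t) (ψ : State w) :
    run f A w gs ((Gate.not t).apply A f ψ) = (Gate.not t).apply A f (run f A w gs ψ) := by
  induction gs generalizing ψ with
  | nil => rfl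
  | cons g gs ih =>
    simp only [listOn_cons] at hg
    rw [run_cons, hg.1.apply_not f A hP ht, ih hg.2, run_cons]

end

end QCount

/-! ### Uncomputation and classical arithmetic -/

namespace QCount

/-! ### Uncomputation -/

section

variable {l : ℕ} (f : BitString l → Bool) {A : Matrix (BitString l) (BitString l) ℂ} {w : ℕ}

/-- The part of a state in which wire `h` does not contain `v`. -/
noncomputable def errPart (h : ℕ) (v : Bool) (ψ : State w) : State w :=
  WithLp.toLp 2 fun c => if c.get h = v then 0 else ψ c

/-- Where wire `h` contains `v`, the CNOT acts on `t` as a NOT (`v = 1`) or as the identity (`v =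
0`), so these amplitudes cancel in the difference. -/
theorem cnot_sub_eq {h t : ℕ} (ht : t < w) (hne : h ≠ t) (v : Bool) (Ψ : State w) :
    (Gate.cnot h t).apply A f Ψ - (if v then (Gate.not t).apply A f Ψ else Ψ) =
      (Gate.cnot h t).apply A f (errPart h v Ψ) -
        (if v then (Gate.not t).apply A f (errPart h v Ψ) else errPart h v Ψ) := by
  ext c
  have hh : ∀ b, (c.put t b).get h = c.get h := fun b => by rw [get_put c ht, if_neg hne]
  cases v
  · cases hc : c.get h
    · simp [Gate.apply, errPart, hc, put_get]
    · simp [Gate.apply, errPart, hc, hh]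
  · cases hc : c.get h
    · simp [Gate.apply, errPart, hc, hh]
    · simp [Gate.apply, errPart, hc, hh]

/-- If the result wire `h` always contained `v`, the CNOT would be a NOT on `t` to the power `v`.
That commutes with the uncomputation, which then restores the memory exactly. By `cnot_sub_eq` the
deviation is a difference of two isometric images of the error part, hence the factor 2. -/
theorem norm_compute_copy_uncompute (hA : A ∈ Matrix.unitaryGroup (BitString l) ℂ)
    {P : ℕ → Prop} {gs : List Gate} (hg : ListOn l P gs) (hP : ∀ i, P i → i < w) {h t : ℕ}
    (hh : h < w) (ht : t < w) (hPt : ¬ P t) (hne : h ≠ t) (m : ℕ → Bool) (v : Bool) :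
    ‖run f A w (gs ++ [.cnot h t] ++ invList gs) (ket w m) -
        ket w (Function.update m t (xor (m t) v))‖ ≤
      2 * ‖errPart h v (run f A w gs (ket w m))‖ := by
  have hgw : ListOn l (· < w) gs := hg.mono hP
  have hcnot : (Gate.cnot h t).On l (· < w) := ⟨hh, ht, hne⟩
  have hnot : (Gate.not t).On l (· < w) := ht
  set Ψ := run f A w gs (ket w m) with hΨ
  set E := errPart h v Ψ
  have hket : run f A w (invList gs) (if v then (Gate.not t).apply A f Ψ else Ψ) =
      ket w (Function.update m t (xor (m t) v)) := by
    cases v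
    · simp [hΨ, hgw.run_inv_run f hA]
    · simp only [if_true]
      rw [hg.inv.run_not f hP hPt, hgw.run_inv_run f hA,
        Gate.Classical.apply_ket f A (g := .not t) trivial hnot]
      simp [Gate.act]
  have hrun : run f A w (gs ++ [.cnot h t] ++ invList gs) (ket w m) =
      run f A w (invList gs) ((Gate.cnot h t).apply A f Ψ) := by
    rw [run_append, run_append]
    rfl
  rw [hrun, ← hket, ← map_sub, hgw.inv.norm_run f hA, cnot_sub_eq f ht hne]
  refine (norm_sub_le _ _).trans ?_
  rw [hcnot.norm_apply f A hA, two_mul]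
  gcongr
  split_ifs
  · rw [hnot.norm_apply f A hA]
  · rfl

/-- The basis state `ket w m` has no error part, so this part of `Ψ` is a part of the difference. -/
theorem norm_errPart_le {h : ℕ} (hh : h < w) {v : Bool} {m : ℕ → Bool} (hm : m h = v)
    (Ψ : State w) : ‖errPart h v Ψ‖ ≤ ‖Ψ - ket w m‖ := by
  rw [EuclideanSpace.norm_eq, EuclideanSpace.norm_eq]
  gcongr with c
  by_cases hc : c.get h = v
  · simp [errPart, hc]
  · have : c ≠ cfg w m := by
      rintro rfl
      exact hc (by rw [get_cfg m hh, hm])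
    simp [errPart, hc, ket_apply, this]

/-- The second list of gates is an isometry and does not amplify the error of the first one. -/
theorem norm_run_sub_trans (hA : A ∈ Matrix.unitaryGroup (BitString l) ℂ) {gs hs : List Gate}
    (hh : ListOn l (· < w) hs) {m m' m'' : ℕ → Bool} {a b : ℝ}
    (h1 : ‖run f A w gs (ket w m) - ket w m'‖ ≤ a)
    (h2 : ‖run f A w hs (ket w m') - ket w m''‖ ≤ b) :
    ‖run f A w (gs ++ hs) (ket w m) - ket w m''‖ ≤ a + b := by
  have : run f A w (gs ++ hs) (ket w m) - ket w m'' =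
      run f A w hs (run f A w gs (ket w m) - ket w m') +
        (run f A w hs (ket w m') - ket w m'') := by
    rw [run_append, map_sub]
    abel
  rw [this]
  refine (norm_add_le _ _).trans (add_le_add ?_ h2)
  rwa [hh.norm_run f hA]

end

/-! ### Numbers in registers -/

/-- The number in the `k` wires from `s` on, least significant bit first. -/
def val (m : ℕ → Bool) (s : ℕ) : ℕ → ℕ
  | 0 => 0
  | k + 1 => val m s k + if m (s + k) then 2 ^ k else 0

theorem val_congr {m m' : ℕ → Bool} {s s' k : ℕ} (h : ∀ i < k, m (s + i) = m' (s' + i)) :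
    val m s k = val m' s' k := by
  induction k with
  | zero => rfl
  | succ k ih => rw [val, val, ih fun i hi => h i (by omega), h k (by omega)]

theorem val_lt (m : ℕ → Bool) (s k : ℕ) : val m s k < 2 ^ k := by
  induction k with
  | zero => simp [val]
  | succ k ih => rw [val, pow_succ]; split_ifs <;> omega

theorem val_eq_zero {m : ℕ → Bool} {s k : ℕ} (h : ∀ i < k, m (s + i) = false) :
    val m s k = 0 := by
  induction k with
  | zero => rfl
  | succ k ih => rw [val, ih fun i hi => h i (by omega), h k (by omega)]; rfl

theorem eq_of_val_eq {m m' : ℕ → Bool} {s s' k : ℕ} (h : val m s k = val m' s' k) :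
    ∀ i < k, m (s + i) = m' (s' + i) := by
  induction k with
  | zero => intro i hi; omega
  | succ k ih =>
    have h1 := val_lt m s k
    have h2 := val_lt m' s' k
    rw [val, val] at h
    have hb : m (s + k) = m' (s' + k) := by
      cases hm : m (s + k) <;> cases hm' : m' (s' + k) <;> simp [hm, hm'] at h ⊢ <;> omega
    intro i hi
    rcases Nat.lt_succ_iff_lt_or_eq.1 hi with hi | rfl
    · exact ih (by rw [hb] at h; omega) i hi
    · exact hb

/-- The number encoded by a bit string. -/
def num {l : ℕ} (x : BitString l) : ℕ := val (setReg (fun _ => false) 0 x) 0 l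

theorem val_eq_num {l : ℕ} (m : ℕ → Bool) (s : ℕ) : val m s l = num (reg l m s) :=
  val_congr fun i hi => by simp [setReg, reg, hi]

theorem num_lt {l : ℕ} (x : BitString l) : num x < 2 ^ l := val_lt _ _ _

theorem num_injective {l : ℕ} : Function.Injective (num (l := l)) := by
  intro x y h
  funext i
  simpa [setReg] using eq_of_val_eq h i i.2

/-! ### Comparators -/

/-- The comparison of the numbers at `x` and `z`, computed from the least significant bit on;
`b` is the value for equal numbers. -/
def carry (m : ℕ → Bool) (x z : ℕ) (b : Bool) : ℕ → Bool
  | 0 => b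
  | k + 1 =>
    -- This polynomial over the field with two elements equals the bit of `z` if the two bits
    -- differ, and the previous carry otherwise. Its five monomials are the five gates of `cmpStep`.
    xor (xor (xor (xor (m (z + k)) (m (x + k) && m (z + k))) (carry m x z b k))
      (m (x + k) && carry m x z b k)) (m (z + k) && carry m x z b k)

theorem carry_eq (m : ℕ → Bool) (x z : ℕ) (b : Bool) (k : ℕ) :
    carry m x z b k = decide (val m x k < val m z k ∨ (val m x k = val m z k ∧ b = true)) := by
  induction k with
  | zero => simp [carry, val]
  | succ k ih =>
    have h1 := val_lt m x k
    have h2 := val_lt m z k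
    rw [carry, ih, val, val]
    rcases lt_trichotomy (val m x k) (val m z k) with h | h | h <;>
      cases m (x + k) <;> cases m (z + k) <;> simp [h] <;> grind

/-- Compute bit `k + 1` of a comparison into wire `u + k + 1`. -/
def cmpStep (x z u k : ℕ) : List Gate :=
  [.cnot (z + k) (u + k + 1), .toffoli (x + k) (z + k) (u + k + 1), .cnot (u + k) (u + k + 1),
    .toffoli (x + k) (u + k) (u + k + 1), .toffoli (z + k) (u + k) (u + k + 1)]

/-- Compare the `K`-bit numbers at `x` and `z`; wire `u` contains the value for equal numbers, the
result is computed into wire `u + K`. -/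
def cmp (K x z u : ℕ) : List Gate := (List.range K).flatMap (cmpStep x z u)

theorem acts_cmp {l : ℕ} (f : BitString l → Bool) {K x z u : ℕ} {m : ℕ → Bool}
    (hx : ∀ k < K, x + k ≤ u ∨ u + K < x + k) (hz : ∀ k < K, z + k ≤ u ∨ u + K < z + k)
    (hm : ∀ k < K, m (u + k + 1) = false) :
    acts f (cmp K x z u) m =
      fun i => if u < i ∧ i ≤ u + K then carry m x z (m u) (i - u) else m i := by
  induction K with
  | zero =>
    funext i
    rw [if_neg (by omega)]
    rfl
  | succ K ih =>
    have hc : cmp (K + 1) x z u = cmp K x z u ++ cmpStep x z u K := by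
      simp [cmp, List.range_succ]
    have hx' := hx K (by omega)
    have hz' := hz K (by omega)
    rw [hc, acts_append, ih (fun k hk => by have := hx k (by omega); omega)
      (fun k hk => by have := hz k (by omega); omega) fun k hk => hm k (by omega)]
    have e1 : ¬ (u < x + K ∧ x + K ≤ u + K) := by omega
    have e2 : ¬ (u < z + K ∧ z + K ≤ u + K) := by omega
    have e3 : x + K ≠ u + K + 1 := by omega
    have e4 : z + K ≠ u + K + 1 := by omega
    have e5 : ∀ b, (if u < u + K ∧ u + K ≤ u + K then carry m x z b (u + K - u) else m (u + K)) =
        if 0 < K then carry m x z b K else m (u + K) := by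
      intro b
      simp
    -- For `K = 0` the previous carry is the initial wire `u` itself, which no step has written.
    have e6 : (if 0 < K then carry m x z (m u) K else m (u + K)) = carry m x z (m u) K := by
      split_ifs with h
      · rfl
      · obtain rfl : K = 0 := by omega
        rfl
    funext i
    simp only [cmpStep, acts_cons, acts_nil, Gate.act, Function.update_of_ne e3,
      Function.update_of_ne e4, Function.update_self, if_neg e1, if_neg e2, e5, e6,
      Function.update_of_ne (show u + K ≠ u + K + 1 by omega), Function.update_idem]
    by_cases hi : i = u + K + 1
    · subst hi
      rw [Function.update_self, if_neg (by omega), if_pos (by omega), hm K (by omega),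
        Bool.false_xor, show u + K + 1 - u = K + 1 by omega]
      rfl
    · rw [Function.update_of_ne hi]
      congr 1
      rw [eq_iff_iff]
      omega

theorem acts_cmp_last {l : ℕ} (f : BitString l → Bool) {K x z u : ℕ} {m : ℕ → Bool}
    (hx : ∀ k < K, x + k ≤ u ∨ u + K < x + k) (hz : ∀ k < K, z + k ≤ u ∨ u + K < z + k)
    (hm : ∀ k < K, m (u + k + 1) = false) :
    acts f (cmp K x z u) m (u + K) =
      decide (val m x K < val m z K ∨ (val m x K = val m z K ∧ m u = true)) := by
  rw [acts_cmp f hx hz hm, ← carry_eq]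
  rcases Nat.eq_zero_or_pos K with rfl | hK
  · simp [carry]
  · simp [hK]

theorem acts_cmp_of_not {l : ℕ} (f : BitString l → Bool) {K x z u : ℕ} {m : ℕ → Bool}
    (hx : ∀ k < K, x + k ≤ u ∨ u + K < x + k) (hz : ∀ k < K, z + k ≤ u ∨ u + K < z + k)
    (hm : ∀ k < K, m (u + k + 1) = false) {i : ℕ} (hi : i ≤ u ∨ u + K < i) :
    acts f (cmp K x z u) m i = m i := by
  rw [acts_cmp f hx hz hm]
  exact if_neg (by omega)

theorem listOn_cmp {l K x z u : ℕ} {P : ℕ → Prop} (hx : ∀ k < K, P (x + k))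
    (hz : ∀ k < K, P (z + k)) (hu : ∀ k ≤ K, P (u + k)) (hxu : x + K ≤ u ∨ u + K < x)
    (hzu : z + K ≤ u ∨ u + K < z) (hxz : x ≠ z) : ListOn l P (cmp K x z u) := by
  rw [cmp, listOn_flatMap]
  intro k hk
  have hk := List.mem_range.1 hk
  have h1 := hx k hk
  have h2 := hz k hk
  have h3 := hu k hk.le
  have h4 := hu (k + 1) hk
  rw [← add_assoc] at h4
  simp only [cmpStep, listOn_cons, listOn_nil, Gate.On, h1, h2, h3, h4, true_and, and_true]
  omega

theorem listClassical_cmp (K x z u : ℕ) : ListClassical (cmp K x z u) := by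
  simp [cmp, listClassical_flatMap, cmpStep, Gate.Classical]

theorem length_cmp (K x z u : ℕ) : (cmp K x z u).length = 5 * K := by
  simp [cmp, List.length_flatMap, cmpStep, mul_comm]

/-! ### Tests of a search register -/

/-- Compute into wire `2 l + 5` whether the register at `s` contains `0…0`. -/
def zeroTest (l s : ℕ) : List Gate := .not (l + 5) :: cmp l s 4 (l + 5)

/-- Compute into wire `3` whether the register at `s` contains a good element `x` that is less
than the number at `y` and greater than (or, if wire `b` contains `0`, equal to) the number
at `z`. -/
def goodTest (l s b z y : ℕ) : List Gate :=
  .cnot b (l + 5) :: (cmp (l + 1) s z (l + 5) ++ (cmp (l + 1) s y (2 * l + 7) ++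
    [.test s 1, .not (2 * l + 6), .toffoli (2 * l + 6) 1 2, .toffoli 2 (3 * l + 8) 3]))

/-- The condition that `goodTest` decides. -/
def isGood {l : ℕ} (f : BitString l → Bool) (m : ℕ → Bool) (b z y : ℕ) (x : BitString l) : Bool :=
  f x && (!decide (num x < val m z (l + 1) ∨ (num x = val m z (l + 1) ∧ m b = true)) &&
    decide (num x < val m y (l + 1)))

/-- Zero is the only number that is at most zero. The clean wires from `4` on provide the second
operand `0`, and the NOT on the initial carry `l + 5` makes the comparison non-strict. -/
theorem acts_zeroTest {l : ℕ} (f : BitString l → Bool) {s : ℕ} (hs : 3 * l + 9 ≤ s)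
    {m : ℕ → Bool} (hm : ∀ i, 1 ≤ i → i < 3 * l + 9 → m i = false) :
    acts f (zeroTest l s) m (2 * l + 5) = decide (reg l m s = fun _ => false) := by
  set m1 := Gate.act f (.not (l + 5)) m with hm1
  have h1 : ∀ i, i ≠ l + 5 → m1 i = m i := fun i hi => Function.update_of_ne hi _ _
  have h0 : m1 (l + 5) = true := by simp [hm1, Gate.act, hm (l + 5) (by omega) (by omega)]
  have hz : num (fun _ : Fin l => false) = 0 := val_eq_zero fun i hi => by simp [setReg]
  rw [zeroTest, acts_cons, ← hm1, show 2 * l + 5 = l + 5 + l by omega, acts_cmp_last f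
    (fun k hk => by omega) (fun k hk => by omega) fun k hk => by
      rw [h1 _ (by omega)]; exact hm _ (by omega) (by omega)]
  rw [val_congr (m' := m) (s' := s) fun i hi => h1 _ (by omega), val_eq_num,
    val_eq_zero (s := 4) fun i hi => by rw [h1 _ (by omega)]; exact hm _ (by omega) (by omega),
    ← hz, h0]
  rw [decide_eq_decide]
  constructor
  · rintro (h | h)
    · omega
    · exact num_injective h.1
  · intro h
    exact .inr ⟨by rw [h], rfl⟩

/-- The bounds at `z` and `y` have `l + 1` bits, so the search register is read together with its
padding wire `s + l`. The initial carry of the first comparison is a copy of `b`, which decides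
whether equality with `z` excludes; that of the second is the clean wire `2 l + 7`, so that
comparison is strict. -/
theorem acts_goodTest {l : ℕ} (f : BitString l → Bool) {s b z y : ℕ} (hs : 3 * l + 9 ≤ s)
    (hz : 3 * l + 9 ≤ z) (hy : 3 * l + 9 ≤ y) {m : ℕ → Bool}
    (hm : ∀ i, 1 ≤ i → i < 3 * l + 9 → m i = false) (hsl : m (s + l) = false) :
    acts f (goodTest l s b z y) m 3 = isGood f m b z y (reg l m s) := by
  have hvs : val m s (l + 1) = num (reg l m s) := by simp [val, hsl, val_eq_num]
  set m1 := Gate.act f (.cnot b (l + 5)) m with hm1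
  have h1 : ∀ i, i ≠ l + 5 → m1 i = m i := fun i hi => Function.update_of_ne hi _ _
  have h1b : m1 (l + 5) = m b := by simp [hm1, Gate.act, hm (l + 5) (by omega) (by omega)]
  have hx1 : ∀ k < l + 1, s + k ≤ l + 5 ∨ l + 5 + (l + 1) < s + k := by omega
  have hz1 : ∀ k < l + 1, z + k ≤ l + 5 ∨ l + 5 + (l + 1) < z + k := by omega
  have hc1 : ∀ k < l + 1, m1 (l + 5 + k + 1) = false := fun k hk => by
    rw [h1 _ (by omega)]; exact hm _ (by omega) (by omega)
  set m2 := acts f (cmp (l + 1) s z (l + 5)) m1 with hm2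
  have h2 : ∀ i, i < l + 5 ∨ 2 * l + 6 < i → m2 i = m i := fun i hi => by
    rw [hm2, acts_cmp_of_not f hx1 hz1 hc1 (by omega), h1 i (by omega)]
  have h2r : m2 (2 * l + 6) = decide (num (reg l m s) < val m z (l + 1) ∨
      (num (reg l m s) = val m z (l + 1) ∧ m b = true)) := by
    rw [hm2, show 2 * l + 6 = l + 5 + (l + 1) by omega, acts_cmp_last f hx1 hz1 hc1, h1b,
      val_congr (m' := m) (s' := z) fun i hi => h1 _ (by omega),
      val_congr (m' := m) (s' := s) fun i hi => h1 _ (by omega)]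
    simp [hvs]
  have hx2 : ∀ k < l + 1, s + k ≤ 2 * l + 7 ∨ 2 * l + 7 + (l + 1) < s + k := by omega
  have hy2 : ∀ k < l + 1, y + k ≤ 2 * l + 7 ∨ 2 * l + 7 + (l + 1) < y + k := by omega
  have hc2 : ∀ k < l + 1, m2 (2 * l + 7 + k + 1) = false := fun k hk => by
    rw [h2 _ (by omega)]; exact hm _ (by omega) (by omega)
  set m3 := acts f (cmp (l + 1) s y (2 * l + 7)) m2 with hm3
  have h3 : ∀ i, i ≤ 2 * l + 7 ∨ 3 * l + 8 < i → m3 i = m2 i := fun i hi => by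
    rw [hm3, acts_cmp_of_not f hx2 hy2 hc2 (by omega)]
  have h3r : m3 (3 * l + 8) = decide (num (reg l m s) < val m y (l + 1)) := by
    rw [hm3, show 3 * l + 8 = 2 * l + 7 + (l + 1) by omega, acts_cmp_last f hx2 hy2 hc2,
      h2 (2 * l + 7) (by omega), hm (2 * l + 7) (by omega) (by omega),
      val_congr (m' := m) (s' := y) fun i hi => h2 _ (by omega),
      val_congr (m' := m) (s' := s) fun i hi => h2 _ (by omega)]
    simp [hvs]
  have h3s : ∀ b, reg l (Function.update m3 1 b) s = reg l m s := fun b => funext fun i => by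
    simp only [reg]
    rw [Function.update_of_ne (by omega), h3 _ (by omega), h2 _ (by omega)]
  have h3s' : reg l m3 s = reg l m s := funext fun i => by
    simp only [reg]
    rw [h3 _ (by omega), h2 _ (by omega)]
  have e1 : m3 1 = false := by
    rw [h3 _ (by omega), h2 _ (by omega)]; exact hm _ (by omega) (by omega)
  have e2 : m3 2 = false := by
    rw [h3 _ (by omega), h2 _ (by omega)]; exact hm _ (by omega) (by omega)
  have e3 : m3 3 = false := by
    rw [h3 _ (by omega), h2 _ (by omega)]; exact hm _ (by omega) (by omega)
  rw [goodTest, acts_cons, acts_append, acts_append, ← hm1, ← hm2, ← hm3]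
  have n1 : 2 * l + 6 ≠ 1 := by omega
  have n2 : 3 * l + 8 ≠ 2 := by omega
  have n3 : 3 * l + 8 ≠ 2 * l + 6 := by omega
  have n4 : 3 * l + 8 ≠ 1 := by omega
  have n5 : 3 ≠ 2 * l + 6 := by omega
  have n6 : 2 ≠ 2 * l + 6 := by omega
  have n7 : 1 ≠ 2 * l + 6 := by omega
  simp only [acts_cons, acts_nil, Gate.act, Function.update_self, Function.update_apply, n1, n2,
    n3, n4, n5, n6, n7, if_false, h3s', e1, e2, e3, h3r, h3 (2 * l + 6) (by omega), h2r,
    isGood]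
  cases f (reg l m s) <;> simp

theorem listOn_zeroTest {l s : ℕ} {P : ℕ → Prop} (h : ∀ i, 1 ≤ i → i < 3 * l + 9 → P i)
    (hs : 3 * l + 9 ≤ s) (hP : ∀ k ≤ l, P (s + k)) : ListOn l P (zeroTest l s) := by
  rw [zeroTest, listOn_cons]
  exact ⟨h _ (by omega) (by omega), listOn_cmp (fun k hk => hP k hk.le)
    (fun k hk => h _ (by omega) (by omega)) (fun k hk => h _ (by omega) (by omega)) (by omega)
    (by omega) (by omega)⟩

theorem listOn_goodTest {l s b z y : ℕ} {P : ℕ → Prop} (h : ∀ i, 1 ≤ i → i < 3 * l + 9 → P i)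
    (hs : 3 * l + 9 ≤ s) (hb : 3 * l + 9 ≤ b) (hz : 3 * l + 9 ≤ z) (hy : 3 * l + 9 ≤ y)
    (hPs : ∀ k ≤ l, P (s + k)) (hPb : P b) (hPz : ∀ k ≤ l, P (z + k)) (hPy : ∀ k ≤ l, P (y + k))
    (hsz : s ≠ z) (hsy : s ≠ y) : ListOn l P (goodTest l s b z y) := by
  simp only [goodTest, listOn_cons, listOn_append, listOn_nil, Gate.On, and_true]
  refine ⟨⟨hPb, h _ (by omega) (by omega), by omega⟩, ?_, ?_, ⟨hPs, ?_, by omega⟩, ?_, ?_, ?_⟩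
  · exact listOn_cmp (fun k hk => hPs k (by omega)) (fun k hk => hPz k (by omega))
      (fun k hk => h _ (by omega) (by omega)) (by omega) (by omega) hsz
  · exact listOn_cmp (fun k hk => hPs k (by omega)) (fun k hk => hPy k (by omega))
      (fun k hk => h _ (by omega) (by omega)) (by omega) (by omega) hsy
  · exact h _ (by omega) (by omega)
  · exact h _ (by omega) (by omega)
  · exact ⟨h _ (by omega) (by omega), h _ (by omega) (by omega), h _ (by omega) (by omega),
      by omega, by omega, by omega⟩
  · exact ⟨h _ (by omega) (by omega), h _ (by omega) (by omega), h _ (by omega) (by omega),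
      by omega, by omega, by omega⟩

theorem listClassical_zeroTest (l s : ℕ) : ListClassical (zeroTest l s) := by
  simp [zeroTest, listClassical_cmp, Gate.Classical]

theorem listClassical_goodTest (l s b z y : ℕ) : ListClassical (goodTest l s b z y) := by
  simp [goodTest, listClassical_cmp, Gate.Classical]

theorem length_zeroTest (l s : ℕ) : (zeroTest l s).length = 5 * l + 1 := by
  simp [zeroTest, length_cmp]

theorem length_goodTest (l s b z y : ℕ) : (goodTest l s b z y).length = 10 * l + 15 := by
  simp [goodTest, length_cmp]
  ring

/-! ### Conjugation by tests -/

/-- Apply the phase `-1` if the test `W` computes `1` into wire `h`. -/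
def flagPhase (W : List Gate) (h : ℕ) : List Gate := W ++ ([.had h, .not h, .had h] ++ W.reverse)

/-- Compute into wire `t` whether wire `a` contains `1` and the test `W` fails. -/
def flagFail (W : List Gate) (h a t : ℕ) : List Gate :=
  W ++ ([.not h, .toffoli a h t, .not h] ++ W.reverse)

section

variable {l : ℕ} (f : BitString l → Bool) (A : Matrix (BitString l) (BitString l) ℂ) {w : ℕ}

/-- Conjugating NOT by Hadamard gates gives the phase flip `Z`. -/
theorem run_had_not_had {h : ℕ} (hh : h < w) (m : ℕ → Bool) :
    run f A w [.had h, .not h, .had h] (ket w m) = (if m h then (-1 : ℂ) else 1) • ket w m := by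
  have h4 : ((√2 : ℝ) : ℂ) ^ 2 = 2 := by
    rw [← Complex.ofReal_pow, Real.sq_sqrt (by norm_num)]
    norm_num
  have h3 : ((√2 : ℝ) : ℂ) ≠ 0 := by simp
  have key : ∀ ψ : State w, ∀ c, run f A w [.had h, .not h, .had h] ψ c =
      (if c.get h then (-1 : ℂ) else 1) * ψ c := by
    intro ψ c
    have hc := put_get c h
    simp only [run_cons, run_nil]
    cases hb : c.get h <;> rw [hb] at hc <;>
      simp [Gate.apply, get_put c hh, put_put, hb, hc] <;> field_simp <;> rw [h4] <;> ring
  ext c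
  rw [key]
  by_cases hc : c = cfg w m
  · subst hc
    rw [get_cfg m hh]
    rfl
  · have : ket w m c = 0 := by simp [ket_apply, hc]
    rw [PiLp.smul_apply, this, mul_zero, smul_zero]

theorem run_flagPhase {W : List Gate} (hc : ListClassical W) (hw : ListOn l (· < w) W) {h : ℕ}
    (hh : h < w) (m : ℕ → Bool) : run f A w (flagPhase W h) (ket w m) =
      (if acts f W m h then (-1 : ℂ) else 1) • ket w m := by
  rw [flagPhase, run_append, hc.run_ket f A hw, run_append, run_had_not_had f A hh, map_smul,
    hc.reverse.run_ket f A hw.reverse, hw.acts_reverse]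

/-- The test touches neither `a` nor `t`, so its reversal undoes everything except the bit written
to `t`. -/
theorem acts_flagFail {P : ℕ → Prop} {W : List Gate} (hW : ListOn l P W) {h a t : ℕ}
    (ha : ¬ P a) (ht : ¬ P t) (hah : a ≠ h) (hth : t ≠ h) (m : ℕ → Bool) (hm : m t = false) :
    acts f (flagFail W h a t) m = Function.update m t (m a && !acts f W m h) := by
  have h1 : acts f [.not h, .toffoli a h t, .not h] (acts f W m) =
      Function.update (acts f W m) t (m a && !acts f W m h) := by
    funext i
    simp only [acts_cons, acts_nil, Gate.act, Function.update_apply, hW.acts_of_not f m ha,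
      hW.acts_of_not f m ht, hm, if_neg hah, if_neg hth, if_neg hth.symm]
    split_ifs with h1 h2 <;> simp_all
  rw [flagFail, acts_append, acts_append, h1, hW.reverse.acts_update f _ ht, hW.acts_reverse]

theorem listOn_flagPhase {P : ℕ → Prop} {W : List Gate} (hW : ListOn l P W) {h : ℕ} (hh : P h) :
    ListOn l P (flagPhase W h) := by
  simp [flagPhase, hW, hW.reverse, Gate.On, hh]

theorem listOn_flagFail {P : ℕ → Prop} {W : List Gate} (hW : ListOn l P W) {h a t : ℕ}
    (hh : P h) (ha : P a) (ht : P t) (hah : a ≠ h) (hat : a ≠ t) (hth : h ≠ t) :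
    ListOn l P (flagFail W h a t) := by
  simp [flagFail, hW, hW.reverse, Gate.On, hh, ha, ht, hah, hat, hth]

theorem listClassical_flagFail {W : List Gate} (hW : ListClassical W) (h a t : ℕ) :
    ListClassical (flagFail W h a t) := by
  simp [flagFail, hW, hW.reverse, Gate.Classical]

theorem length_flagPhase (W : List Gate) (h : ℕ) :
    (flagPhase W h).length = 2 * W.length + 3 := by
  simp [flagPhase]
  ring

theorem length_flagFail (W : List Gate) (h a t : ℕ) :
    (flagFail W h a t).length = 2 * W.length + 3 := by
  simp [flagFail]
  ring

end

end QCount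

/-! ### Amplitude amplification with tripling angles -/

namespace QCount

/-! ### States of one register -/

section

variable {l : ℕ} (f : BitString l → Bool) (A : Matrix (BitString l) (BitString l) ℂ) {w : ℕ}

/-- The state `v` in the register at `s`, where all other wires contain `m`. -/
noncomputable def emb (w : ℕ) (m : ℕ → Bool) (s : ℕ) (v : BitString l → ℂ) : State w :=
  ∑ x, v x • ket w (setReg m s x)

theorem cfg_setReg (m : ℕ → Bool) (s : ℕ) (x : BitString l) :
    cfg w (setReg m s x) = (cfg w m).putReg s x := by
  rw [putReg_eq]
  refine cfg_congr fun i hi => ?_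
  simp only [setReg, get_cfg m hi]

/-- Blanking the register on both sides expresses that `c` and `m` agree off the register. -/
theorem emb_apply {s : ℕ} (hs : s + l ≤ w) (m : ℕ → Bool) (v : BitString l → ℂ)
    (c : Config w) : emb w m s v c =
      if c.putReg s (fun _ : Fin l => false) = (cfg w m).putReg s (fun _ : Fin l => false)
      then v (c.getReg l s) else 0 := by
  have key : ∀ x : BitString l, c = (cfg w m).putReg s x ↔
      c.putReg s (fun _ : Fin l => false) = (cfg w m).putReg s (fun _ : Fin l => false) ∧
        c.getReg l s = x := by
    intro x
    constructor
    · rintro rfl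
      exact ⟨putReg_putReg _ _ _ _, getReg_putReg _ hs _⟩
    · rintro ⟨h, rfl⟩
      conv_lhs => rw [← putReg_getReg l c s]
      rw [← putReg_putReg c s (fun _ => false), h, putReg_putReg]
  simp only [emb, WithLp.ofLp_sum, Finset.sum_apply, PiLp.smul_apply, ket_apply, cfg_setReg, key,
    smul_eq_mul, mul_ite, mul_one, mul_zero]
  split_ifs with h
  · simp [h]
  · simp [h]

theorem prep_emb {s : ℕ} (hs : s + l ≤ w) (m : ℕ → Bool) (v : BitString l → ℂ) :
    (Gate.prep s).apply A f (emb w m s v) = emb w m s (A.mulVec v) := by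
  ext c
  rw [emb_apply hs]
  simp only [Gate.apply, emb_apply hs, putReg_putReg, getReg_putReg c hs]
  split_ifs with h
  · rfl
  · simp

theorem run_emb_of_forall {gs : List Gate} {m : ℕ → Bool} {s : ℕ} {d : BitString l → ℂ}
    (h : ∀ x, run f A w gs (ket w (setReg m s x)) = d x • ket w (setReg m s x))
    (v : BitString l → ℂ) :
    run f A w gs (emb w m s v) = emb w m s ((Matrix.diagonal d).mulVec v) := by
  simp only [emb, map_sum, map_smul, h, Matrix.mulVec_diagonal, smul_smul, mul_comm]

theorem emb_single {m : ℕ → Bool} {s : ℕ} (hm : reg l m s = fun _ => false) :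
    emb w m s (Pi.single (fun _ : Fin l => false) 1) = ket w m := by
  rw [emb, Finset.sum_eq_single (fun _ : Fin l => false)]
  · rw [Pi.single_eq_same, one_smul, ← hm, setReg_reg]
  · intro x _ hx
    rw [Pi.single_eq_of_ne hx, zero_smul]
  · simp

/-! ### Amplitude amplification -/

/-- Amplitude amplification for the register at `s`, with reflections `R` about the good elements
and `S` about zero. Each level triples the angle. -/
def amplify (s : ℕ) (R S : List Gate) : ℕ → List Gate
  | 0 => [.prep s]
  | i + 1 => amplify s R S i ++ (R ++ (invList (amplify s R S i) ++ (S ++ amplify s R S i)))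

/-- The matrix of `amplify`. -/
noncomputable def ampMatrix (D S : Matrix (BitString l) (BitString l) ℂ) :
    ℕ → Matrix (BitString l) (BitString l) ℂ
  | 0 => A
  | i + 1 => ampMatrix D S i * (S * ((ampMatrix D S i).conjTranspose * (D * ampMatrix D S i)))

theorem listOn_amplify {P : ℕ → Prop} {s : ℕ} {R S : List Gate} (hs : ∀ k ≤ l, P (s + k))
    (hR : ListOn l P R) (hS : ListOn l P S) (i : ℕ) : ListOn l P (amplify s R S i) := by
  induction i with
  | zero => simpa [amplify, Gate.On] using hs
  | succ i ih => simp [amplify, ih, ih.inv, hR, hS]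

/-- Lengths satisfy `a (i + 1) = 3 a i + |R| + |S|`. The added `c` absorbs the inhomogeneous term,
so that the bound exactly triples. -/
theorem length_amplify_le {s c : ℕ} {R S : List Gate} (h : R.length + S.length + 2 ≤ c) (i : ℕ) :
    (amplify s R S i).length + c ≤ 3 ^ i * (2 * c) := by
  induction i with
  | zero => simp [amplify]; omega
  | succ i ih =>
    have : 3 ^ (i + 1) * (2 * c) = 3 * (3 ^ i * (2 * c)) := by ring
    simp only [amplify, List.length_append, length_invList]
    omega

variable {A} in
theorem ampMatrix_mem (hA : A ∈ Matrix.unitaryGroup (BitString l) ℂ)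
    {D S : Matrix (BitString l) (BitString l) ℂ} (hD : D ∈ Matrix.unitaryGroup (BitString l) ℂ)
    (hS : S ∈ Matrix.unitaryGroup (BitString l) ℂ) (i : ℕ) :
    ampMatrix A D S i ∈ Matrix.unitaryGroup (BitString l) ℂ := by
  induction i with
  | zero => exact hA
  | succ i ih =>
    exact mul_mem ih (mul_mem hS (mul_mem
      (Matrix.star_eq_conjTranspose (ampMatrix A D S i) ▸ Unitary.star_mem ih) (mul_mem hD ih)))

variable {A} in
-- Once the reflections act on the register as the matrices `D` and `S`, with the other wires fixed
-- at `m`, the whole recursion stays inside the register.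
theorem run_amplify (hA : A ∈ Matrix.unitaryGroup (BitString l) ℂ)
    {D S : Matrix (BitString l) (BitString l) ℂ} (hD : D ∈ Matrix.unitaryGroup (BitString l) ℂ)
    (hS : S ∈ Matrix.unitaryGroup (BitString l) ℂ) {s : ℕ} (hs : s + l < w) {m : ℕ → Bool}
    {Rs Ss : List Gate} (hRw : ListOn l (· < w) Rs) (hSw : ListOn l (· < w) Ss)
    (hRs : ∀ v, run f A w Rs (emb w m s v) = emb w m s (D.mulVec v))
    (hSs : ∀ v, run f A w Ss (emb w m s v) = emb w m s (S.mulVec v)) (i : ℕ)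
    (v : BitString l → ℂ) :
    run f A w (amplify s Rs Ss i) (emb w m s v) = emb w m s ((ampMatrix A D S i).mulVec v) := by
  induction i generalizing v with
  | zero => exact prep_emb f A hs.le m v
  | succ i ih =>
    have hM := ampMatrix_mem hA hD hS i
    set M := ampMatrix A D S i with hMdef
    have hinv : ∀ v, run f A w (invList (amplify s Rs Ss i)) (emb w m s v) =
        emb w m s (M.conjTranspose.mulVec v) := by
      intro v
      -- The inverse circuit is understood on outputs of the circuit; since `M` is unitary, every
      -- vector gives such an output.
      have h1 : v = M.mulVec (M.conjTranspose.mulVec v) := by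
        rw [Matrix.mulVec_mulVec, ← Matrix.star_eq_conjTranspose, Matrix.mem_unitaryGroup_iff.1 hM,
          Matrix.one_mulVec]
      conv_lhs => rw [h1, ← ih]
      exact (listOn_amplify (fun k hk => by omega) hRw hSw i).run_inv_run f hA _
    simp only [amplify, run_append, ih, hRs, hinv, hSs, ampMatrix, ← hMdef]
    simp only [← Matrix.mulVec_mulVec]

end

/-! ### The amplitudes after amplification -/

section

variable {l : ℕ} {A : Matrix (BitString l) (BitString l) ℂ} {X : Finset (BitString l)}

/-- The signs `-1` on the elements that satisfy `good`. -/
noncomputable def signs (good : BitString l → Bool) : BitString l → ℂ :=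
  fun x => if good x then -1 else 1

theorem diagonal_signs_mem (good : BitString l → Bool) :
    Matrix.diagonal (signs good) ∈ Matrix.unitaryGroup (BitString l) ℂ := by
  rw [Matrix.mem_unitaryGroup_iff, Matrix.star_eq_conjTranspose, Matrix.diagonal_conjTranspose,
    Matrix.diagonal_mul_diagonal, ← Matrix.diagonal_one]
  congr 1
  funext x
  simp only [signs, Pi.star_apply]
  split_ifs <;> simp

/-- The amplitudes of the register after `i` levels of amplification. -/
noncomputable def ampVec (A : Matrix (BitString l) (BitString l) ℂ) (good : BitString l → Bool)
    (i : ℕ) : BitString l → ℂ :=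
  (ampMatrix A (Matrix.diagonal (signs good))
    (Matrix.diagonal (signs fun x => decide (x = fun _ => false))) i).mulVec
      (Pi.single (fun _ => false) 1)

/-- The sign flip on zero is the identity minus twice the projection to the zero vector. Conjugation
by `M` moves this projection to the column of `M` at zero. -/
theorem reflection_mulVec {M : Matrix (BitString l) (BitString l) ℂ}
    (hM : M ∈ Matrix.unitaryGroup (BitString l) ℂ) (u : BitString l → ℂ) (x : BitString l) :
    (M.mulVec ((Matrix.diagonal (signs fun x => decide (x = fun _ => false))).mulVec
      (M.conjTranspose.mulVec u))) x =
        u x - 2 * (∑ y, star (M y fun _ => false) * u y) * M x fun _ => false := by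
  have h1 : (Matrix.diagonal (signs fun x : BitString l => decide (x = fun _ => false))).mulVec
      (M.conjTranspose.mulVec u) = M.conjTranspose.mulVec u -
        (2 * ∑ y, star (M y fun _ => false) * u y) • Pi.single (fun _ => false) 1 := by
    funext y
    rw [Matrix.mulVec_diagonal]
    by_cases hy : y = fun _ => false
    · subst hy
      simp only [signs, decide_true, if_true, Pi.sub_apply, Pi.smul_apply, Pi.single_eq_same,
        smul_eq_mul, mul_one, Matrix.mulVec, dotProduct, Matrix.conjTranspose_apply]
      ring
    · simp [signs, hy]
  have h2 : M.mulVec (M.conjTranspose.mulVec u) = u := by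
    rw [Matrix.mulVec_mulVec, ← Matrix.star_eq_conjTranspose, Matrix.mem_unitaryGroup_iff.1 hM,
      Matrix.one_mulVec]
  rw [h1, Matrix.mulVec_sub, h2, Matrix.mulVec_smul]
  simp

theorem ampVec_zero (hA : Prepares A X) (good : BitString l → Bool) (x : BitString l) :
    ampVec A good 0 x = if x ∈ X then ((1 / √(X.card : ℝ) : ℝ) : ℂ) else 0 := by
  simp [ampVec, ampMatrix, hA.2]

/-- The weight `|G| / |X|` of the good elements. -/
noncomputable def weight (X : Finset (BitString l)) (good : BitString l → Bool) : ℝ :=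
  (X.filter fun x => good x = true).card / X.card

theorem sum_ampVec_zero (hA : Prepares A X) (hX : X.Nonempty) (good : BitString l → Bool)
    (a b : ℝ) : ∑ x, (if good x then a else b) * ‖ampVec A good 0 x‖ ^ 2 =
      a * weight X good + b * (1 - weight X good) := by
  have hc : (X.card : ℝ) ≠ 0 := by exact_mod_cast hX.card_pos.ne'
  have hsum : (X.card : ℝ) = (X.filter fun x => good x = true).card +
      (X.filter fun x => ¬ good x = true).card := by
    exact_mod_cast (Finset.card_filter_add_card_filter_not (s := X) fun x => good x = true).symm
  have h1 : ∀ x, (if good x then a else b) * ‖ampVec A good 0 x‖ ^ 2 =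
      if x ∈ X then (if good x then a / X.card else b / X.card) else 0 := by
    intro x
    rw [ampVec_zero hA]
    split_ifs <;> simp [div_eq_mul_inv]
  rw [Finset.sum_congr rfl fun x _ => h1 x, ← Finset.sum_filter, Finset.filter_univ_mem,
    Finset.sum_ite, Finset.sum_const, Finset.sum_const, weight, nsmul_eq_mul, nsmul_eq_mul,
    ← sub_eq_iff_eq_add'.2 hsum]
  field_simp

theorem weight_nonneg (X : Finset (BitString l)) (good : BitString l → Bool) :
    0 ≤ weight X good := by
  rw [weight]
  positivity

theorem weight_le_one (X : Finset (BitString l)) (good : BitString l → Bool) :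
    weight X good ≤ 1 := by
  rw [weight]
  exact div_le_one_of_le₀ (by exact_mod_cast Finset.card_filter_le _ _) (by positivity)

/-- The angle whose squared sine is the weight of the good elements. -/
noncomputable def angle (X : Finset (BitString l)) (good : BitString l → Bool) : ℝ :=
  Real.arcsin √(weight X good)

theorem sin_angle (X : Finset (BitString l)) (good : BitString l → Bool) :
    Real.sin (angle X good) = √(weight X good) :=
  Real.sin_arcsin (by linarith [Real.sqrt_nonneg (weight X good)])
    (Real.sqrt_le_one.2 (weight_le_one X good))

theorem sin_sq_angle (X : Finset (BitString l)) (good : BitString l → Bool) :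
    Real.sin (angle X good) ^ 2 = weight X good := by
  rw [sin_angle, Real.sq_sqrt (weight_nonneg X good)]

/-- The state stays in the plane spanned by the good and the bad part of the uniform superposition,
where two reflections compose to a rotation by twice the current angle, up to a sign; hence the
tripling and the factor `(-1) ^ i`. Stating the factors as products with `sin` and `cos` covers the
degenerate cases where one of the parts vanishes. -/
theorem exists_ampVec_eq (hA : Prepares A X) (hX : X.Nonempty) (good : BitString l → Bool)
    (i : ℕ) : ∃ p q : ℝ,
      (∀ x, ampVec A good i x = ((if good x then p else q : ℝ) : ℂ) * ampVec A good 0 x) ∧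
      p * Real.sin (angle X good) = (-1) ^ i * Real.sin (3 ^ i * angle X good) ∧
      q * Real.cos (angle X good) = (-1) ^ i * Real.cos (3 ^ i * angle X good) := by
  induction i with
  | zero => exact ⟨1, 1, by simp⟩
  | succ i ih =>
    obtain ⟨p, q, h, hp, hq⟩ := ih
    have hM := ampMatrix_mem hA.1 (diagonal_signs_mem good)
      (diagonal_signs_mem fun x => decide (x = fun _ => false)) i
    set M := ampMatrix A (Matrix.diagonal (signs good))
      (Matrix.diagonal (signs fun x => decide (x = fun _ => false))) i with hMdef
    have hcol : ∀ x, M x (fun _ => false) = ampVec A good i x := by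
      intro x
      simp [ampVec, ← hMdef]
    set s := Real.sin (angle X good)
    set c := Real.cos (angle X good)
    set φ := 3 ^ i * angle X good with hφ
    set κ : ℝ := q ^ 2 * c ^ 2 - p ^ 2 * s ^ 2 with hκ
    have hs : s ^ 2 = weight X good := sin_sq_angle X good
    have hc : c ^ 2 = 1 - weight X good := by
      have := Real.sin_sq_add_cos_sq (angle X good)
      linarith
    have hκ2 : κ = Real.cos (2 * φ) := by
      rw [hκ, ← mul_pow, ← mul_pow, hp, hq, Real.cos_two_mul', mul_pow, mul_pow, ← pow_mul,
        mul_comm i 2, pow_mul]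
      simp
    -- The overlap of the state with its image under the sign flip on good elements: bad weight
    -- minus good weight, that is `cos² φ - sin² φ = cos (2 φ)`.
    have hinner : ∑ y, star (M y fun _ => false) *
        ((Matrix.diagonal (signs good)).mulVec (M.mulVec (Pi.single (fun _ => false) 1))) y =
          (κ : ℂ) := by
      have : ∀ y, star (M y fun _ => false) *
          ((Matrix.diagonal (signs good)).mulVec (M.mulVec (Pi.single (fun _ => false) 1))) y =
            (((if good y then -p ^ 2 else q ^ 2) * ‖ampVec A good 0 y‖ ^ 2 : ℝ) : ℂ) := by
        intro y
        have h2 : M.mulVec (Pi.single (fun _ => false) 1) = ampVec A good i := rfl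
        rw [Matrix.mulVec_diagonal, hcol, h2, h, signs, Complex.ofReal_mul, Complex.ofReal_pow,
          ← Complex.conj_mul']
        split_ifs <;> simp <;> ring
      rw [Finset.sum_congr rfl fun y _ => this y, ← Complex.ofReal_sum,
        sum_ampVec_zero hA hX, hκ, hs, hc]
      congr 1
      ring
    -- The sign flip turns `(p, q)` into `(-p, q)`, and the reflection subtracts `2 κ (p, q)`. The
    -- angle triples because `sin 3φ = (1 + 2 cos 2φ) sin φ` and `cos 3φ = (2 cos 2φ - 1) cos φ`.
    refine ⟨-(1 + 2 * κ) * p, (1 - 2 * κ) * q, fun x => ?_, ?_, ?_⟩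
    · have : ampVec A good (i + 1) x = (M.mulVec ((Matrix.diagonal
          (signs fun x => decide (x = fun _ => false))).mulVec (M.conjTranspose.mulVec
            ((Matrix.diagonal (signs good)).mulVec
              (M.mulVec (Pi.single (fun _ => false) 1)))))) x := by
        simp only [ampVec, ampMatrix, ← hMdef, ← Matrix.mulVec_mulVec]
      have h2 : M.mulVec (Pi.single (fun _ => false) 1) = ampVec A good i := rfl
      rw [this, reflection_mulVec hM, hinner, hcol, h2, Matrix.mulVec_diagonal, h, signs]
      split_ifs <;> push_cast <;> ring
    · rw [mul_assoc, hp, hκ2, pow_succ (3 : ℝ), mul_comm ((3 : ℝ) ^ i) 3, mul_assoc, ← hφ,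
        Real.sin_three_mul, Real.cos_two_mul]
      have := Real.sin_sq_add_cos_sq φ
      have h3 : Real.cos φ ^ 2 = 1 - Real.sin φ ^ 2 := by linarith
      rw [h3]
      ring
    · rw [mul_assoc, hq, hκ2, pow_succ (3 : ℝ), mul_comm ((3 : ℝ) ^ i) 3, mul_assoc, ← hφ,
        Real.cos_three_mul, Real.cos_two_mul]
      ring

theorem ampVec_eq_zero (hA : Prepares A X) (hX : X.Nonempty) (good : BitString l → Bool) (i : ℕ)
    {x : BitString l} (hx : x ∉ X) : ampVec A good i x = 0 := by
  obtain ⟨p, q, h, -⟩ := exists_ampVec_eq hA hX good i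
  rw [h, ampVec_zero hA, if_neg hx, mul_zero]

theorem sum_bad_ampVec (hA : Prepares A X) (hX : X.Nonempty) (good : BitString l → Bool)
    (i : ℕ) : ∑ x with good x = false, ‖ampVec A good i x‖ ^ 2 =
      Real.cos (3 ^ i * angle X good) ^ 2 := by
  obtain ⟨p, q, h, -, hq⟩ := exists_ampVec_eq hA hX good i
  have h1 : ∀ x, (if good x = false then ‖ampVec A good i x‖ ^ 2 else 0) =
      (if good x then 0 else q ^ 2) * ‖ampVec A good 0 x‖ ^ 2 := by
    intro x
    rw [h]
    cases hx : good x <;> simp [mul_pow]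
  rw [Finset.sum_filter, Finset.sum_congr rfl fun x _ => h1 x, sum_ampVec_zero hA hX, zero_mul,
    zero_add, ← sin_sq_angle, ← Real.cos_sq', ← mul_pow, hq, mul_pow, ← pow_mul, mul_comm i 2,
    pow_mul]
  simp

/-- The factor at level `i` is `cos² (3 ^ i θ)`. The first level whose angle reaches `π / 6` has an
angle of at most `π / 2`, as one step only triples it, so its factor is at most `3 / 4`; the other
factors are at most 1. The number of solutions need not be known. -/
theorem prod_sum_bad_le (hA : Prepares A X) (good : BitString l → Bool)
    (hgood : ∃ x ∈ X, good x = true) {μ : ℕ} (hμ : X.card ≤ 9 ^ μ) :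
    ∏ i ∈ Finset.range (μ + 1), ∑ x with good x = false, ‖ampVec A good i x‖ ^ 2 ≤ 3 / 4 := by
  obtain ⟨x, hxX, hx⟩ := hgood
  have hX : X.Nonempty := ⟨x, hxX⟩
  have hw : 1 / (3 ^ μ : ℝ) ^ 2 ≤ weight X good := by
    rw [weight, ← pow_mul, mul_comm μ 2, pow_mul]
    have h1 : 0 < (X.filter fun x => good x = true).card :=
      Finset.card_pos.2 ⟨x, Finset.mem_filter.2 ⟨hxX, hx⟩⟩
    have h2 : (0 : ℝ) < X.card := by exact_mod_cast hX.card_pos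
    gcongr
    · exact_mod_cast h1
    · norm_num
      exact_mod_cast hμ
  have hsin : 1 / 3 ^ μ ≤ √(weight X good) := by
    apply Real.le_sqrt_of_sq_le
    rwa [div_pow, one_pow]
  have h0 : 0 ≤ angle X good := Real.arcsin_nonneg.2 (Real.sqrt_nonneg _)
  -- From `θ ≥ sin θ ≥ 3 ^ (-μ)`; since `π / 6 < 1`, level `μ` already reaches `π / 6`.
  have hlow : 1 ≤ 3 ^ μ * angle X good := by
    have := Real.sin_le h0
    rw [sin_angle] at this
    have h3 : (0 : ℝ) < 3 ^ μ := by positivity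
    have := hsin.trans this
    rwa [div_le_iff₀' h3] at this
  have hex : ∃ i, Real.pi / 6 ≤ 3 ^ i * angle X good :=
    ⟨μ, le_trans (by linarith [Real.pi_lt_d2]) hlow⟩
  set i := Nat.find hex with hi
  have hi1 : Real.pi / 6 ≤ 3 ^ i * angle X good := Nat.find_spec hex
  have hiμ : i ≤ μ := Nat.find_min' hex (le_trans (by linarith [Real.pi_lt_d2]) hlow)
  have hi2 : 3 ^ i * angle X good ≤ Real.pi / 2 := by
    -- At level 0 the bound is the range of `arcsin`; later it follows from minimality at `i - 1`.
    rcases Nat.eq_zero_or_pos i with h | h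
    · rw [h, pow_zero, one_mul]
      exact Real.arcsin_le_pi_div_two _
    · have := Nat.find_min hex (m := i - 1) (by omega)
      have h3 : (3 : ℝ) ^ i = 3 ^ (i - 1) * 3 := by rw [← pow_succ, Nat.sub_add_cancel h]
      rw [h3]
      linarith
  have hcos : Real.cos (3 ^ i * angle X good) ^ 2 ≤ 3 / 4 := by
    have h4 : 1 / 2 ≤ Real.sin (3 ^ i * angle X good) := by
      rw [← Real.sin_pi_div_six]
      exact Real.sin_le_sin_of_le_of_le_pi_div_two (by linarith [Real.pi_pos]) hi2 hi1
    have := Real.sin_sq_add_cos_sq (3 ^ i * angle X good)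
    nlinarith
  have hmem : i ∈ Finset.range (μ + 1) := Finset.mem_range.2 (by omega)
  rw [Finset.prod_congr rfl fun i _ => sum_bad_ampVec hA hX good i,
    ← Finset.mul_prod_erase _ _ hmem]
  calc Real.cos (3 ^ i * angle X good) ^ 2 *
        ∏ j ∈ (Finset.range (μ + 1)).erase i, Real.cos (3 ^ j * angle X good) ^ 2
      ≤ 3 / 4 * 1 := by
        refine mul_le_mul hcos (Finset.prod_le_one (fun j _ => sq_nonneg _) fun j _ => ?_)
          (Finset.prod_nonneg fun j _ => sq_nonneg _) (by norm_num)
        exact Real.cos_sq_le_one _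
    _ = 3 / 4 := mul_one _

end

end QCount

/-! ### Existence queries by repeated amplification -/

namespace QCount

/-! ### Superpositions of basis states -/

theorem norm_sq_errPart_sum {ι : Type*} [Fintype ι] {w h : ℕ} (hh : h < w) (v : Bool)
    (a : ι → ℂ) {k : ι → ℕ → Bool} (hk : Function.Injective fun i => cfg w (k i)) :
    ‖errPart h v (∑ i, a i • ket w (k i))‖ ^ 2 = ∑ i, if k i h = v then 0 else ‖a i‖ ^ 2 := by
  rw [EuclideanSpace.norm_sq_eq]
  symm
  have happ : ∀ c, (∑ i, a i • ket w (k i)) c = ∑ i, a i * if c = cfg w (k i) then 1 else 0 := by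
    intro c
    simp only [WithLp.ofLp_sum, Finset.sum_apply, PiLp.smul_apply, ket_apply, smul_eq_mul]
  refine Fintype.sum_of_injective _ hk _ _ (fun c hc => ?_) fun i => ?_
  · have : (∑ i, a i • ket w (k i)) c = 0 := by
      rw [happ]
      refine Finset.sum_eq_zero fun i _ => ?_
      rw [if_neg, mul_zero]
      rintro rfl
      exact hc ⟨i, rfl⟩
    simp only [errPart, this]
    simp
  · have : (∑ j, a j • ket w (k j)) (cfg w (k i)) = a i := by
      rw [happ, Finset.sum_eq_single i]
      · simp
      · intro j _ hj
        rw [if_neg fun h => hj (hk h.symm), mul_zero]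
      · simp
    simp only [errPart, get_cfg _ hh, this]
    split_ifs <;> simp

/-! ### Queries -/

/-- The address of the search register number `j`, if there are `M` search registers. -/
def regAt (l M j : ℕ) : ℕ := 3 * l + 10 + M + j * (l + 1)

theorem regAt_succ (l M j : ℕ) : regAt l M (j + 1) = regAt l M j + (l + 1) := by
  simp only [regAt]; ring

theorem regAt_add_le {l M j k : ℕ} (h : j < k) : regAt l M j + (l + 1) ≤ regAt l M k := by
  rw [← regAt_succ]
  exact Nat.add_le_add_left (Nat.mul_le_mul_right _ h) _

theorem le_regAt (l M j : ℕ) : 3 * l + 10 + M ≤ regAt l M j := Nat.le_add_right _ _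

/-- Amplification of search register `j`. -/
def stage (l M μ b z y j : ℕ) : List Gate :=
  amplify (regAt l M j) (flagPhase (goodTest l (regAt l M j) b z y) 3)
    (flagPhase (zeroTest l (regAt l M j)) (2 * l + 5)) (j % (μ + 1))

/-- Compute into wire `3 l + 9 + K` whether none of the first `K` search registers contains a good
element. -/
def verdict (l M b z y K : ℕ) : List Gate :=
  .not (3 * l + 9) :: (List.range K).flatMap fun j =>
    flagFail (goodTest l (regAt l M j) b z y) 3 (3 * l + 9 + j) (3 * l + 9 + j + 1)

/-- The search for a good element, with result in wire `3 l + 9 + M`. -/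
def core (l M μ b z y : ℕ) : List Gate :=
  (List.range M).flatMap (stage l M μ b z y) ++ verdict l M b z y M

/-- Add to wire `t` whether there is no good element. -/
def query (l M μ b z y t : ℕ) : List Gate :=
  core l M μ b z y ++ [.cnot (3 * l + 9 + M) t] ++ invList (core l M μ b z y)

/-- Overwrite the first search registers. -/
def setRegs (l M : ℕ) (m : ℕ → Bool) : (K : ℕ) → (Fin K → BitString l) → ℕ → Bool
  | 0, _ => m
  | K + 1, x => setReg (setRegs l M m K (Fin.init x)) (regAt l M K) (x (Fin.last K))

section

variable {l M : ℕ}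

theorem setRegs_of_not (m : ℕ → Bool) {K : ℕ} (x : Fin K → BitString l) {i : ℕ}
    (hi : ∀ j < K, i < regAt l M j ∨ regAt l M j + l ≤ i) : setRegs l M m K x i = m i := by
  induction K with
  | zero => rfl
  | succ K ih =>
    rw [setRegs, setReg_of_lt _ _ _ (hi K (by omega)), ih _ fun j hj => hi j (by omega)]

theorem reg_setRegs (m : ℕ → Bool) {K : ℕ} (x : Fin K → BitString l) (j : Fin K) :
    reg l (setRegs l M m K x) (regAt l M j) = x j := by
  induction K with
  | zero => exact j.elim0
  | succ K ih =>
    rw [setRegs]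
    refine Fin.lastCases ?_ (fun j => ?_) j
    · rw [Fin.val_last, reg_setReg]
    · rw [Fin.val_castSucc]
      have h1 := ih (Fin.init x) j
      rw [show x j.castSucc = Fin.init x j from rfl, ← h1]
      funext i
      have := regAt_add_le (l := l) (M := M) j.2
      exact setReg_of_lt _ _ _ (.inl (by omega))

/-- The wires of the work space, except for the answer wire `0`, contain `0`. -/
def Clean (l M : ℕ) (m : ℕ → Bool) : Prop := ∀ i, 1 ≤ i → i < regAt l M M → m i = false

variable (f : BitString l → Bool) {b z y : ℕ}

theorem isGood_congr {m m' : ℕ → Bool} {d : ℕ} (hb : d ≤ b) (hz : d ≤ z) (hy : d ≤ y)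
    (h : ∀ i, d ≤ i → m i = m' i) : isGood f m b z y = isGood f m' b z y := by
  funext x
  rw [isGood, isGood, val_congr (s := z) (s' := z) (k := l + 1) fun i _ => h (z + i) (by omega),
    val_congr (s := y) (s' := y) (k := l + 1) fun i _ => h (y + i) (by omega), h b hb]

theorem listOn_goodTest_regAt {P : ℕ → Prop} (hP : ∀ i, 1 ≤ i → i < regAt l M M → P i)
    (hb : regAt l M M ≤ b) (hz : regAt l M M ≤ z) (hy : regAt l M M ≤ y) (hPb : P b)
    (hPz : ∀ k ≤ l, P (z + k)) (hPy : ∀ k ≤ l, P (y + k)) {j : ℕ} (hj : j < M) :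
    ListOn l P (goodTest l (regAt l M j) b z y) := by
  have h1 := regAt_add_le (l := l) (M := M) hj
  have h2 := le_regAt l M j
  exact listOn_goodTest (fun i hi hi' => hP i hi (by omega)) (by omega) (by omega) (by omega)
    (by omega) (fun k hk => hP _ (by omega) (by omega)) hPb hPz hPy (by omega) (by omega)

theorem listOn_stage {P : ℕ → Prop} (hP : ∀ i, 1 ≤ i → i < regAt l M M → P i)
    (hb : regAt l M M ≤ b) (hz : regAt l M M ≤ z) (hy : regAt l M M ≤ y) (hPb : P b)
    (hPz : ∀ k ≤ l, P (z + k)) (hPy : ∀ k ≤ l, P (y + k)) (μ : ℕ) {j : ℕ} (hj : j < M) :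
    ListOn l P (stage l M μ b z y j) := by
  have h1 := regAt_add_le (l := l) (M := M) hj
  have h2 := le_regAt l M j
  refine listOn_amplify (fun k hk => hP _ (by omega) (by omega)) (listOn_flagPhase
    (listOn_goodTest_regAt hP hb hz hy hPb hPz hPy hj) (hP _ (by omega) (by omega)))
    (listOn_flagPhase ?_ (hP _ (by omega) (by omega))) _
  exact listOn_zeroTest (fun i hi hi' => hP i hi (by omega)) (by omega)
    fun k hk => hP _ (by omega) (by omega)

theorem listOn_verdict {P : ℕ → Prop} (hP : ∀ i, 1 ≤ i → i < regAt l M M → P i)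
    (hb : regAt l M M ≤ b) (hz : regAt l M M ≤ z) (hy : regAt l M M ≤ y) (hPb : P b)
    (hPz : ∀ k ≤ l, P (z + k)) (hPy : ∀ k ≤ l, P (y + k)) {K : ℕ} (hK : K ≤ M) :
    ListOn l P (verdict l M b z y K) := by
  have h2 := le_regAt l M M
  rw [verdict, listOn_cons, listOn_flatMap]
  refine ⟨hP _ (by omega) (by omega), fun j hj => ?_⟩
  have hj := List.mem_range.1 hj
  exact listOn_flagFail (listOn_goodTest_regAt hP hb hz hy hPb hPz hPy (by omega))
    (hP _ (by omega) (by omega)) (hP _ (by omega) (by omega)) (hP _ (by omega) (by omega))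
    (by omega) (by omega) (by omega)

theorem listOn_core {P : ℕ → Prop} (hP : ∀ i, 1 ≤ i → i < regAt l M M → P i)
    (hb : regAt l M M ≤ b) (hz : regAt l M M ≤ z) (hy : regAt l M M ≤ y) (hPb : P b)
    (hPz : ∀ k ≤ l, P (z + k)) (hPy : ∀ k ≤ l, P (y + k)) (μ : ℕ) :
    ListOn l P (core l M μ b z y) := by
  rw [core, listOn_append, listOn_flatMap]
  exact ⟨fun j hj => listOn_stage hP hb hz hy hPb hPz hPy μ (List.mem_range.1 hj),
    listOn_verdict hP hb hz hy hPb hPz hPy le_rfl⟩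

theorem listOn_query {P : ℕ → Prop} (hP : ∀ i, 1 ≤ i → i < regAt l M M → P i)
    (hb : regAt l M M ≤ b) (hz : regAt l M M ≤ z) (hy : regAt l M M ≤ y) (hPb : P b)
    (hPz : ∀ k ≤ l, P (z + k)) (hPy : ∀ k ≤ l, P (y + k)) (μ : ℕ) {t : ℕ} (hPt : P t)
    (ht : regAt l M M ≤ t) : ListOn l P (query l M μ b z y t) := by
  have h2 := le_regAt l M M
  have := listOn_core hP hb hz hy hPb hPz hPy μ
  rw [query, listOn_append, listOn_append, listOn_cons]
  exact ⟨⟨this, ⟨hP _ (by omega) (by omega), hPt, by omega⟩, listOn_nil⟩, this.inv⟩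

theorem length_query_le (l M μ b z y t : ℕ) :
    (query l M μ b z y t).length ≤ (M + 1) * 3 ^ μ * (160 * l + 230) := by
  have h1 : ∀ j, (stage l M μ b z y j).length ≤ 3 ^ μ * (60 * l + 80) := by
    intro j
    -- The reflections have `2 (10 l + 15) + 3` and `2 (5 l + 1) + 3` gates, together `30 l + 38`.
    have h := length_amplify_le (s := regAt l M j) (c := 30 * l + 40)
      (R := flagPhase (goodTest l (regAt l M j) b z y) 3)
      (S := flagPhase (zeroTest l (regAt l M j)) (2 * l + 5))
      (by rw [length_flagPhase, length_flagPhase, length_goodTest, length_zeroTest]; omega)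
      (j % (μ + 1))
    have h2 : 3 ^ (j % (μ + 1)) * (2 * (30 * l + 40)) ≤ 3 ^ μ * (60 * l + 80) := by
      refine Nat.mul_le_mul (Nat.pow_le_pow_right (by norm_num) ?_) (by omega)
      have := Nat.mod_lt j (show μ + 1 > 0 by omega)
      omega
    rw [stage]
    omega
  have h2 : ((List.range M).flatMap (stage l M μ b z y)).length ≤ M * (3 ^ μ * (60 * l + 80)) := by
    rw [List.length_flatMap]
    refine (List.sum_le_card_nsmul _ (3 ^ μ * (60 * l + 80)) ?_).trans (by simp)
    intro n hn
    obtain ⟨j, -, rfl⟩ := List.mem_map.1 hn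
    exact h1 j
  have h3 : (verdict l M b z y M).length = M * (20 * l + 33) + 1 := by
    simp only [verdict, List.length_cons, List.length_flatMap, length_flagFail, length_goodTest,
      List.map_const', List.length_range, List.sum_replicate, smul_eq_mul]
    ring
  have h4 : 1 ≤ 3 ^ μ := Nat.one_le_pow _ _ (by norm_num)
  have h5 : (core l M μ b z y).length ≤ M * (3 ^ μ * (60 * l + 80)) + (M * (20 * l + 33) + 1) := by
    rw [core, List.length_append]
    omega
  simp only [query, List.length_append, length_invList, List.length_singleton]
  have h6 : M * (20 * l + 33) ≤ M * (3 ^ μ * (20 * l + 33)) :=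
    Nat.mul_le_mul_left _ (Nat.le_mul_of_pos_left _ h4)
  have h7 : (M + 1) * 3 ^ μ * (160 * l + 230) = 2 * (M * (3 ^ μ * (60 * l + 80))) +
      2 * (M * (3 ^ μ * (20 * l + 33))) + 4 * (M * 3 ^ μ) + 3 ^ μ * (160 * l + 230) := by ring
  have h8 : 230 ≤ 3 ^ μ * (160 * l + 230) := le_trans (by omega) (Nat.le_mul_of_pos_left _ h4)
  omega

/-- The wires from `3 l + 9` on form a chain of conjunctions. Its first wire is set to true, and
each test passes the truth on exactly if it fails. -/
theorem acts_verdict {m : ℕ → Bool} (hm : ∀ i, 1 ≤ i → i < 3 * l + 10 + M → m i = false)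
    (hpad : ∀ j < M, m (regAt l M j + l) = false)
    (hb : regAt l M M ≤ b) (hz : regAt l M M ≤ z) (hy : regAt l M M ≤ y) {K : ℕ} (hK : K ≤ M) :
    acts f (verdict l M b z y K) m = fun i => if 3 * l + 9 ≤ i ∧ i ≤ 3 * l + 9 + K
      then decide (∀ j < i - (3 * l + 9), isGood f m b z y (reg l m (regAt l M j)) = false)
      else m i := by
  induction K with
  | zero =>
    funext i
    simp only [verdict, List.range_zero, List.flatMap_nil, acts_cons, acts_nil, Gate.act,
      Function.update_apply, hm (3 * l + 9) (by omega) (by omega)]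
    by_cases h : i = 3 * l + 9
    · subst h
      simp
    · rw [if_neg h, if_neg (by omega)]
  | succ K ih =>
    have h2 := le_regAt l M K
    have h1 := regAt_add_le (l := l) (M := M) (show K < M by omega)
    have hv : verdict l M b z y (K + 1) = verdict l M b z y K ++
        flagFail (goodTest l (regAt l M K) b z y) 3 (3 * l + 9 + K) (3 * l + 9 + K + 1) := by
      simp [verdict, List.range_succ]
    -- The test avoids all wires of the chain.
    have hW : ListOn l (fun i => (1 ≤ i ∧ i < 3 * l + 9) ∨ 3 * l + 10 + M ≤ i)
        (goodTest l (regAt l M K) b z y) :=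
      listOn_goodTest (fun i hi hi' => .inl ⟨hi, hi'⟩) (by omega) (by omega) (by omega) (by omega)
        (fun k hk => .inr (by omega)) (.inr (by omega)) (fun k hk => .inr (by omega))
        (fun k hk => .inr (by omega)) (by omega) (by omega)
    rw [hv, acts_append, ih (by omega), acts_flagFail f hW (by omega) (by omega) (by omega)
      (by omega) _ (by rw [if_neg (by omega)]; exact hm _ (by omega) (by omega)),
      acts_goodTest f (by omega) (by omega) (by omega)]
    rotate_left
    · intro i hi hi'
      rw [if_neg (by omega)]
      exact hm i hi (by omega)
    · rw [if_neg (by omega)]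
      exact hpad K (by omega)
    · rw [isGood_congr f (m' := m) (d := regAt l M M) hb hz hy fun i hi => if_neg (by omega)]
      have hr : reg l (fun i => if 3 * l + 9 ≤ i ∧ i ≤ 3 * l + 9 + K
          then decide (∀ j < i - (3 * l + 9), isGood f m b z y (reg l m (regAt l M j)) = false)
          else m i) (regAt l M K) = reg l m (regAt l M K) :=
        funext fun i => if_neg (by omega)
      rw [hr, if_pos (by omega)]
      funext i
      by_cases h : i = 3 * l + 9 + K + 1
      · subst h
        rw [Function.update_self, if_pos (by omega),
          show 3 * l + 9 + K - (3 * l + 9) = K by omega,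
          show 3 * l + 9 + K + 1 - (3 * l + 9) = K + 1 by omega, Bool.eq_iff_iff]
        simp only [Bool.and_eq_true, decide_eq_true_eq, Bool.not_eq_true', Nat.lt_succ_iff_lt_or_eq,
          or_imp, forall_and, forall_eq]
      · rw [Function.update_of_ne h]
        congr 1
        rw [eq_iff_iff]
        omega

variable {w : ℕ} {A : Matrix (BitString l) (BitString l) ℂ} {X : Finset (BitString l)}

/-- Register `j` is still zero, so amplification starts from the zero vector. The tests see only
this register, the clean work wires and the bounds above `regAt l M M`, so the condition does not
depend on the contents `x` of the earlier registers. Hence the registers end up in a product state.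
-/
theorem run_stage (hA : Prepares A X) {m : ℕ → Bool} (hm : Clean l M m)
    (hb : regAt l M M ≤ b) (hz : regAt l M M ≤ z) (hy : regAt l M M ≤ y) (hbw : b < w)
    (hzw : z + l < w) (hyw : y + l < w) (μ : ℕ) {j : ℕ} (hj : j < M) (x : Fin j → BitString l) :
    run f A w (stage l M μ b z y j) (ket w (setRegs l M m j x)) =
      ∑ u, ampVec A (isGood f m b z y) (j % (μ + 1)) u •
        ket w (setReg (setRegs l M m j x) (regAt l M j) u) := by
  have h1 := regAt_add_le (l := l) (M := M) hj
  have h2 := le_regAt l M j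
  set s := regAt l M j with hs
  set m' := setRegs l M m j x with hm'
  have hlow : ∀ i, i < 3 * l + 10 + M → m' i = m i := fun i hi =>
    setRegs_of_not m x fun k hk => .inl (lt_of_lt_of_le hi (le_regAt l M k))
  have hhigh : ∀ i, s ≤ i → m' i = m i := fun i hi => setRegs_of_not m x fun k hk => .inr (by
    have := regAt_add_le (l := l) (M := M) hk
    omega)
  have hWw : ListOn l (· < w) (goodTest l s b z y) :=
    listOn_goodTest_regAt (fun i _ hi => by omega) hb hz hy hbw (fun k hk => by omega)
      (fun k hk => by omega) hj
  have hZw : ListOn l (· < w) (zeroTest l s) :=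
    listOn_zeroTest (fun i _ hi => by omega) (by omega) fun k hk => by omega
  have hanc : ∀ u : BitString l, ∀ i, 1 ≤ i → i < 3 * l + 9 → setReg m' s u i = false := by
    intro u i hi hi'
    rw [setReg_of_lt _ _ _ (.inl (by omega)), hlow i (by omega)]
    exact hm i hi (by omega)
  have hreg : reg l m' s = fun _ => false := funext fun i => by
    simp only [reg]
    rw [hhigh _ (by omega)]
    exact hm _ (by omega) (by omega)
  rw [stage, ← hs, ← emb_single hreg, run_amplify f hA.1 (diagonal_signs_mem (isGood f m b z y))
    (diagonal_signs_mem fun x => decide (x = fun _ => false)) (by omega)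
    (listOn_flagPhase hWw (by omega)) (listOn_flagPhase hZw (by omega))]
  · rfl
  · refine run_emb_of_forall f A fun u => ?_
    have hpad : setReg m' s u (s + l) = false := by
      rw [setReg_of_lt _ _ _ (.inr (by omega)), hhigh _ (by omega)]
      exact hm _ (by omega) (by omega)
    rw [run_flagPhase f A (listClassical_goodTest l s b z y) hWw (by omega),
      acts_goodTest f (by omega) (by omega) (by omega) (hanc u) hpad, reg_setReg,
      isGood_congr f (m' := m) hb hz hy fun i hi => by
        rw [setReg_of_lt _ _ _ (.inr (by omega)), hhigh i (by omega)]]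
    rfl
  · refine run_emb_of_forall f A fun u => ?_
    rw [run_flagPhase f A (listClassical_zeroTest l s) hZw (by omega),
      acts_zeroTest f (by omega) (hanc u), reg_setReg]
    rfl

theorem run_stages (hA : Prepares A X) {m : ℕ → Bool} (hm : Clean l M m)
    (hb : regAt l M M ≤ b) (hz : regAt l M M ≤ z) (hy : regAt l M M ≤ y) (hbw : b < w)
    (hzw : z + l < w) (hyw : y + l < w) (μ : ℕ) {K : ℕ} (hK : K ≤ M) :
    run f A w ((List.range K).flatMap (stage l M μ b z y)) (ket w m) =
      ∑ x : Fin K → BitString l, (∏ j : Fin K, ampVec A (isGood f m b z y) (j % (μ + 1)) (x j)) •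
        ket w (setRegs l M m K x) := by
  induction K with
  | zero => simp [setRegs]
  | succ K ih =>
    rw [List.range_succ, List.flatMap_append, run_append, ih (by omega), map_sum]
    simp only [List.flatMap_singleton, map_smul,
      run_stage f hA hm hb hz hy hbw hzw hyw μ (show K < M by omega), Finset.smul_sum, smul_smul]
    rw [← (Fin.snocEquiv fun _ : Fin (K + 1) => BitString l).sum_comp, Fintype.sum_prod_type,
      Finset.sum_comm]
    refine Finset.sum_congr rfl fun u _ => Finset.sum_congr rfl fun x _ => ?_
    simp [Fin.snocEquiv, setRegs, Fin.prod_univ_castSucc]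

theorem run_core (hA : Prepares A X) {m : ℕ → Bool} (hm : Clean l M m)
    (hb : regAt l M M ≤ b) (hz : regAt l M M ≤ z) (hy : regAt l M M ≤ y) (hbw : b < w)
    (hzw : z + l < w) (hyw : y + l < w) (μ : ℕ) :
    run f A w (core l M μ b z y) (ket w m) =
      ∑ x : Fin M → BitString l, (∏ j : Fin M, ampVec A (isGood f m b z y) (j % (μ + 1)) (x j)) •
        ket w (acts f (verdict l M b z y M) (setRegs l M m M x)) := by
  rw [core, run_append, run_stages f hA hm hb hz hy hbw hzw hyw μ le_rfl]
  simp only [map_sum, map_smul]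
  refine Finset.sum_congr rfl fun x _ => ?_
  rw [ListClassical.run_ket]
  · simp [verdict, listClassical_flatMap, Gate.Classical, listClassical_flagFail,
      listClassical_goodTest]
  · exact listOn_verdict (fun i _ hi => by omega) hb hz hy hbw (fun k hk => by omega)
      (fun k hk => by omega) le_rfl

theorem prod_range_mul_mod (F : ℕ → ℝ) (r k : ℕ) :
    ∏ j ∈ Finset.range (r * k), F (j % k) = (∏ i ∈ Finset.range k, F i) ^ r := by
  induction r with
  | zero => simp
  | succ r ih =>
    rw [Nat.succ_mul, Finset.prod_range_add, ih, pow_succ]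
    congr 1
    refine Finset.prod_congr rfl fun i hi => ?_
    rw [Nat.mul_add_mod_self_right, Nat.mod_eq_of_lt (Finset.mem_range.1 hi)]

/-- The error is one-sided. If a solution exists, the verdict is wrong only where all registers
miss, and this weight is a product over the registers. If there is none, amplitudes vanish outside
`X`, so no register can report a solution. -/
theorem norm_errPart_core_le (hA : Prepares A X) (hX : X.Nonempty) {m : ℕ → Bool}
    (hm : Clean l M m) (hb : regAt l M M ≤ b) (hz : regAt l M M ≤ z) (hy : regAt l M M ≤ y)
    (hbw : b < w) (hzw : z + l < w) (hyw : y + l < w) {μ e : ℕ} (hμ : X.card ≤ 9 ^ μ)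
    (hM : M = 5 * e * (μ + 1)) :
    ‖errPart (3 * l + 9 + M) (!decide (∃ x ∈ X, isGood f m b z y x = true))
      (run f A w (core l M μ b z y) (ket w m))‖ ≤ (1 / 2) ^ e := by
  have hMM := le_regAt l M M
  have hv : ∀ x : Fin M → BitString l, acts f (verdict l M b z y M) (setRegs l M m M x) =
      fun i => if 3 * l + 9 ≤ i ∧ i ≤ 3 * l + 9 + M then decide (∀ j < i - (3 * l + 9),
        isGood f m b z y (reg l (setRegs l M m M x) (regAt l M j)) = false)
      else setRegs l M m M x i := by
    intro x
    rw [acts_verdict f _ _ hb hz hy le_rfl, isGood_congr f (m' := m) hb hz hy]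
    · intro i hi
      refine setRegs_of_not m x fun k hk => .inr ?_
      have := regAt_add_le (l := l) (M := M) hk
      omega
    · intro i hi hi'
      rw [setRegs_of_not m x fun k hk => .inl (lt_of_lt_of_le hi' (le_regAt l M k))]
      exact hm i hi (by omega)
    · intro j hj
      have h2 := regAt_add_le (l := l) (M := M) hj
      have h3 := le_regAt l M j
      rw [setRegs_of_not m x fun k hk => ?_]
      · exact hm _ (by omega) (by omega)
      · rcases lt_trichotomy j k with h | rfl | h
        · have := regAt_add_le (l := l) (M := M) h
          exact .inl (by omega)
        · exact .inr le_rfl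
        · have := regAt_add_le (l := l) (M := M) h
          exact .inr (by omega)
  have hflag : ∀ x : Fin M → BitString l,
      acts f (verdict l M b z y M) (setRegs l M m M x) (3 * l + 9 + M) =
        decide (∀ j, isGood f m b z y (x j) = false) := by
    intro x
    simp only [hv]
    rw [if_pos (by omega), show 3 * l + 9 + M - (3 * l + 9) = M by omega, decide_eq_decide]
    constructor
    · intro h j
      rw [← h j j.2, reg_setRegs]
    · intro h j hj
      rw [← h ⟨j, hj⟩, ← reg_setRegs m x ⟨j, hj⟩]
  -- The verdict leaves the search registers intact, so different contents give orthogonal basis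
  -- states and weights simply add.
  have hinj : Function.Injective fun x : Fin M → BitString l =>
      cfg w (acts f (verdict l M b z y M) (setRegs l M m M x)) := by
    intro x x' h
    funext j
    rw [← reg_setRegs (M := M) m x j, ← reg_setRegs (M := M) m x' j]
    funext i
    have h1 := regAt_add_le (l := l) (M := M) j.2
    have h2 := le_regAt l M j
    have h3 := congrArg (fun c : Config w => c.get (regAt l M j + i)) h
    simp only [get_cfg _ (show regAt l M j + i < w by omega), hv] at h3
    rwa [if_neg (by omega), if_neg (by omega)] at h3
  set good := isGood f m b z y
  rw [← pow_le_pow_iff_left₀ (norm_nonneg _) (by positivity) two_ne_zero,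
    run_core f hA hm hb hz hy hbw hzw hyw, norm_sq_errPart_sum (by omega) _ _ hinj]
  simp only [hflag, norm_prod, ← Finset.prod_pow]
  by_cases hE : ∃ x ∈ X, good x = true
  · have hsum : ∀ x : Fin M → BitString l,
        (if decide (∀ j, good (x j) = false) = !decide (∃ x ∈ X, good x = true) then (0 : ℝ)
          else ∏ j : Fin M, ‖ampVec A good (j % (μ + 1)) (x j)‖ ^ 2) =
        if x ∈ Fintype.piFinset fun _ : Fin M => Finset.univ.filter fun u => good u = false
          then ∏ j : Fin M, ‖ampVec A good (j % (μ + 1)) (x j)‖ ^ 2 else 0 := by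
      intro x
      simp only [decide_eq_true hE, Bool.not_true, decide_eq_false_iff_not, Fintype.mem_piFinset,
        Finset.mem_filter, Finset.mem_univ, true_and, ite_not]
    -- The sum over tuples of bad elements factors over the registers; grouping these into `5 e`
    -- cycles through the levels gives a power of the product in `prod_sum_bad_le`.
    rw [Finset.sum_congr rfl fun x _ => hsum x, ← Finset.sum_filter, Finset.filter_univ_mem,
      ← Finset.prod_univ_sum (fun _ : Fin M => Finset.univ.filter fun u => good u = false)
        fun (j : Fin M) u => ‖ampVec A good (j % (μ + 1)) u‖ ^ 2,
      Fin.prod_univ_eq_prod_range (fun j => ∑ u with good u = false,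
        ‖ampVec A good (j % (μ + 1)) u‖ ^ 2) M, hM,
      prod_range_mul_mod (fun j => ∑ u with good u = false, ‖ampVec A good j u‖ ^ 2)]
    calc _ ≤ (3 / 4 : ℝ) ^ (5 * e) := by
          refine pow_le_pow_left₀ (Finset.prod_nonneg fun i _ => ?_) (prod_sum_bad_le hA good hE hμ) _
          exact Finset.sum_nonneg fun u _ => sq_nonneg _
      -- Five cycles suffice because `(3 / 4) ^ 5 = 243 / 1024 ≤ 1 / 4`.
      _ ≤ ((1 / 2) ^ e) ^ 2 := by
          rw [← pow_mul (1 / 2 : ℝ), mul_comm e 2, pow_mul (1 / 2 : ℝ), pow_mul (3 / 4 : ℝ)]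
          exact pow_le_pow_left₀ (by norm_num) (by norm_num) _
  · refine le_trans (le_of_eq (Finset.sum_eq_zero fun x _ => ?_)) (sq_nonneg _)
    by_cases hx : ∀ j, good (x j) = false
    · rw [if_pos]
      rw [decide_eq_true hx, decide_eq_false hE, Bool.not_false]
    · rw [if_neg (by rw [decide_eq_false hx, decide_eq_false hE]; decide)]
      push Not at hx
      obtain ⟨j, hj⟩ := hx
      have hj' : good (x j) = true := by simpa using hj
      refine Finset.prod_eq_zero (Finset.mem_univ j) ?_
      rw [ampVec_eq_zero hA hX good _ fun h => hE ⟨x j, h, hj'⟩]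
      simp

theorem norm_query_sub_le (hA : Prepares A X) (hX : X.Nonempty) {m : ℕ → Bool}
    (hm : Clean l M m) (hb : regAt l M M ≤ b) (hz : regAt l M M ≤ z) (hy : regAt l M M ≤ y)
    (hbw : b < w) (hzw : z + l < w) (hyw : y + l < w) {μ e : ℕ} (hμ : X.card ≤ 9 ^ μ)
    (hM : M = 5 * e * (μ + 1)) {t : ℕ} (ht : regAt l M M ≤ t) (htw : t < w) (htb : t ≠ b)
    (htz : t < z ∨ z + l < t) (hty : t < y ∨ y + l < t) (hmt : m t = false) :
    ‖run f A w (query l M μ b z y t) (ket w m) -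
      ket w (Function.update m t (!decide (∃ x ∈ X, isGood f m b z y x = true)))‖ ≤
        2 * (1 / 2) ^ e := by
  have hMM := le_regAt l M M
  -- The target of the copy must lie outside the computation that is undone.
  have hon : ListOn l (fun i => i < w ∧ i ≠ t) (core l M μ b z y) :=
    listOn_core (fun i _ hi => by omega) hb hz hy (by omega) (fun k hk => by omega)
      (fun k hk => by omega) μ
  have := norm_compute_copy_uncompute f hA.1 hon (fun i hi => hi.1) (h := 3 * l + 9 + M)
    (by omega) htw (by simp) (by omega) m (!decide (∃ x ∈ X, isGood f m b z y x = true))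
  rw [hmt, Bool.false_xor] at this
  refine this.trans ?_
  gcongr
  exact norm_errPart_core_le f hA hX hm hb hz hy hbw hzw hyw hμ hM

end

end QCount

/-! ### Enumeration by binary search -/

namespace QCount

/-! ### Enumeration of the good elements -/

/-- The address of the block of wires with the `j`-th smallest good element: a wire for whether the
element itself is excluded in the next search, the bits of the element (the last one is set if
there is no such element), and the answers to the queries. -/
def blockAt (l M j : ℕ) : ℕ := regAt l M M + j * (2 * l + 3)

theorem blockAt_succ (l M j : ℕ) : blockAt l M (j + 1) = blockAt l M j + (2 * l + 3) := by
  simp only [blockAt]; ring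

theorem blockAt_mono (l M : ℕ) {j k : ℕ} (h : j ≤ k) : blockAt l M j ≤ blockAt l M k :=
  Nat.add_le_add_left (Nat.mul_le_mul_right _ h) _

theorem regAt_le_blockAt (l M j : ℕ) : regAt l M M ≤ blockAt l M j := Nat.le_add_right _ _

/-- Compute bit `k` of the next element. -/
def bitStep (l M μ j k : ℕ) : List Gate :=
  .not (blockAt l M (j + 1) + 1 + k) ::
    (query l M μ (blockAt l M j) (blockAt l M j + 1) (blockAt l M (j + 1) + 1)
      (blockAt l M (j + 1) + l + 2 + k) ++
    [.not (blockAt l M (j + 1) + 1 + k),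
      .cnot (blockAt l M (j + 1) + l + 2 + k) (blockAt l M (j + 1) + 1 + k)])

/-- Compute the next element. -/
def round (l M μ j : ℕ) : List Gate :=
  (List.range (l + 1)).flatMap (fun a => bitStep l M μ j (l - a)) ++ [.not (blockAt l M (j + 1))]

/-- Compute whether there are at least `B` good elements, into wire `blockAt l M B + 1 + l`. -/
def decideCount (l M μ B : ℕ) : List Gate :=
  (List.range B).flatMap (round l M μ) ++ [.not (blockAt l M B + 1 + l)]

theorem listOn_bitStep {l M j k : ℕ} {P : ℕ → Prop} (μ : ℕ)
    (hP : ∀ i, 1 ≤ i → i < blockAt l M (j + 2) → P i) (hk : k ≤ l) :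
    ListOn l P (bitStep l M μ j k) := by
  have h1 := regAt_le_blockAt l M j
  have h2 := blockAt_succ l M j
  have h3 : blockAt l M (j + 2) = _ := blockAt_succ l M (j + 1)
  have h4 := le_regAt l M M
  simp only [bitStep, listOn_cons, listOn_append, listOn_nil, Gate.On, and_true]
  refine ⟨hP _ (by omega) (by omega), ?_, hP _ (by omega) (by omega), hP _ (by omega) (by omega),
    hP _ (by omega) (by omega), by omega⟩
  exact listOn_query (fun i hi hi' => hP i hi (by omega)) h1 (by omega) (by omega)
    (hP _ (by omega) (by omega)) (fun k hk => hP _ (by omega) (by omega))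
    (fun k hk => hP _ (by omega) (by omega)) μ (hP _ (by omega) (by omega)) (by omega)

theorem listOn_round {l M j : ℕ} {P : ℕ → Prop} (μ : ℕ)
    (hP : ∀ i, 1 ≤ i → i < blockAt l M (j + 2) → P i) : ListOn l P (round l M μ j) := by
  have h1 := regAt_le_blockAt l M (j + 1)
  have h3 : blockAt l M (j + 2) = _ := blockAt_succ l M (j + 1)
  have h4 := le_regAt l M M
  simp only [round, listOn_append, listOn_flatMap, listOn_cons, listOn_nil, Gate.On, and_true]
  exact ⟨fun a _ => listOn_bitStep μ hP (by omega), hP _ (by omega) (by omega)⟩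

theorem listOn_decideCount {l M B : ℕ} {P : ℕ → Prop} (μ : ℕ)
    (hP : ∀ i, 1 ≤ i → i < blockAt l M (B + 1) → P i) : ListOn l P (decideCount l M μ B) := by
  have h1 := regAt_le_blockAt l M B
  have h3 := blockAt_succ l M B
  have h4 := le_regAt l M M
  simp only [decideCount, listOn_append, listOn_flatMap, listOn_cons, listOn_nil, Gate.On,
    and_true]
  refine ⟨fun j hj => listOn_round μ fun i hi hi' => hP i hi ?_, hP _ (by omega) (by omega)⟩
  have := List.mem_range.1 hj
  exact hi'.trans_le (blockAt_mono l M (by omega))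

theorem length_decideCount_le (l M μ B : ℕ) : (decideCount l M μ B).length ≤
    B * ((l + 1) * ((M + 1) * 3 ^ μ * (160 * l + 230) + 3) + 1) + 1 := by
  have h1 : ∀ j k, (bitStep l M μ j k).length ≤ (M + 1) * 3 ^ μ * (160 * l + 230) + 3 := by
    intro j k
    have := length_query_le l M μ (blockAt l M j) (blockAt l M j + 1) (blockAt l M (j + 1) + 1)
      (blockAt l M (j + 1) + l + 2 + k)
    simp only [bitStep, List.length_cons, List.length_append, List.length_nil]
    omega
  have hsum : ∀ (n c : ℕ) (F : ℕ → List Gate), (∀ j, (F j).length ≤ c) →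
      ((List.range n).flatMap F).length ≤ n * c := by
    intro n c F hF
    rw [List.length_flatMap]
    refine (List.sum_le_card_nsmul _ c ?_).trans (by simp)
    intro k hk
    obtain ⟨j, -, rfl⟩ := List.mem_map.1 hk
    exact hF j
  have h2 : ∀ j, (round l M μ j).length ≤
      (l + 1) * ((M + 1) * 3 ^ μ * (160 * l + 230) + 3) + 1 := by
    intro j
    have := hsum (l + 1) _ (fun a => bitStep l M μ j (l - a)) fun a => h1 j (l - a)
    simp only [round, List.length_append, List.length_singleton]
    omega
  have := hsum B _ (round l M μ) h2
  simp only [decideCount, List.length_append, List.length_singleton]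
  omega

theorem val_update {m : ℕ → Bool} {s k K : ℕ} (hk : k < K) (hm : m (s + k) = false) (b : Bool) :
    val (Function.update m (s + k) b) s K = val m s K + if b then 2 ^ k else 0 := by
  induction K with
  | zero => omega
  | succ K ih =>
    rw [val, val]
    rcases Nat.lt_succ_iff_lt_or_eq.1 hk with h | rfl
    · rw [ih h, Function.update_of_ne (by omega)]
      omega
    · rw [Function.update_self, hm, val_congr (m' := m) (s' := s) fun i hi =>
        Function.update_of_ne (by omega) _ _]
      simp

section

variable {l M w : ℕ} (f : BitString l → Bool) {A : Matrix (BitString l) (BitString l) ℂ}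
  {X : Finset (BitString l)}

/-- The elements of `X` that are good and not yet enumerated. -/
def remaining (X : Finset (BitString l)) (m : ℕ → Bool) (b z : ℕ) : Finset (BitString l) :=
  X.filter fun x => f x = true ∧
    ¬ (num x < val m z (l + 1) ∨ (num x = val m z (l + 1) ∧ m b = true))

theorem exists_isGood_iff (m : ℕ → Bool) (b z y : ℕ) :
    (∃ x ∈ X, isGood f m b z y x = true) ↔
      ∃ x ∈ remaining f X m b z, num x < val m y (l + 1) := by
  simp only [isGood, remaining, Finset.mem_filter, Bool.and_eq_true, Bool.not_eq_true',
    decide_eq_false_iff_not, decide_eq_true_eq]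
  grind

theorem remaining_congr {m m' : ℕ → Bool} {b z : ℕ} (hz : ∀ i < l + 1, m (z + i) = m' (z + i))
    (hb : m b = m' b) : remaining f X m b z = remaining f X m' b z := by
  rw [remaining, remaining, val_congr hz, hb]

/-- Setting bit `k` on trial turns the candidate into the midpoint of the search interval. The query
writes to the answer wire whether nothing remains below it, and this is the correct value of the
bit. Only the query contributes to the error. -/
theorem norm_bitStep_sub_le (hA : Prepares A X) (hX : X.Nonempty) {m : ℕ → Bool}
    (hm : Clean l M m) {μ e : ℕ} (hμ : X.card ≤ 9 ^ μ) (hM : M = 5 * e * (μ + 1)) {j k : ℕ}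
    (hw : blockAt l M (j + 2) ≤ w) (hk : k ≤ l) (hyk : m (blockAt l M (j + 1) + 1 + k) = false)
    (htk : m (blockAt l M (j + 1) + l + 2 + k) = false) {v : Bool}
    (hv : v = !decide (∃ x ∈ remaining f X m (blockAt l M j) (blockAt l M j + 1),
      num x < val m (blockAt l M (j + 1) + 1) (l + 1) + 2 ^ k)) :
    ‖run f A w (bitStep l M μ j k) (ket w m) -
      ket w (Function.update (Function.update m (blockAt l M (j + 1) + l + 2 + k) v)
        (blockAt l M (j + 1) + 1 + k) v)‖ ≤ 2 * (1 / 2) ^ e := by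
  have h1 := regAt_le_blockAt l M j
  have h2 := blockAt_succ l M j
  have h3 : blockAt l M (j + 2) = _ := blockAt_succ l M (j + 1)
  have h4 := le_regAt l M M
  set y := blockAt l M (j + 1) + 1 with hy
  set t := blockAt l M (j + 1) + l + 2 + k with ht
  set z := blockAt l M j + 1 with hz
  set b := blockAt l M j with hb
  set m1 := Function.update m (y + k) true with hm1
  have h1m : ∀ i, i ≠ y + k → m1 i = m i := fun i hi => Function.update_of_ne hi _ _
  have hclean : Clean l M m1 := fun i hi hi' => by rw [h1m i (by omega)]; exact hm i hi hi'
  have hq := norm_query_sub_le (w := w) f hA hX hclean (b := b) (z := z) (y := y) h1 (by omega)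
    (by omega) (by omega) (by omega) (by omega) hμ hM (t := t) (by omega) (by omega) (by omega)
    (by omega) (by omega) (by rw [h1m t (by omega)]; exact htk)
  have hv' : (!decide (∃ x ∈ X, isGood f m1 b z y x = true)) = v := by
    rw [hv]
    congr 1
    rw [decide_eq_decide, exists_isGood_iff, remaining_congr f (m' := m) (fun i hi => h1m _ (by omega)) (h1m _ (by omega)), hm1,
      val_update (by omega) hyk, if_pos rfl]
  rw [hv'] at hq
  have hlist : bitStep l M μ j k = [.not (y + k)] ++ (query l M μ b z y t ++
    [.not (y + k), .cnot t (y + k)]) := rfl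
  have hon := listOn_bitStep (l := l) (M := M) (j := j) (k := k) (P := (· < w)) μ
    (fun i _ hi => by omega) hk
  rw [hlist, listOn_append, listOn_append] at hon
  have c1 : ‖run f A w [.not (y + k)] (ket w m) - ket w m1‖ ≤ 0 := by
    rw [ListClassical.run_ket f A (by simp [Gate.Classical]) hon.1]
    simp [Gate.act, hyk, hm1]
  have c2 : ‖run f A w [.not (y + k), .cnot t (y + k)] (ket w (Function.update m1 t v)) -
      ket w (Function.update (Function.update m t v) (y + k) v)‖ ≤ 0 := by
    rw [ListClassical.run_ket f A (by simp [Gate.Classical]) hon.2.2]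
    have : acts f [.not (y + k), .cnot t (y + k)] (Function.update m1 t v) =
        Function.update (Function.update m t v) (y + k) v := by
      funext i
      have n1 : y + k ≠ t := by omega
      simp only [acts_cons, acts_nil, Gate.act, Function.update_apply, hm1, n1, n1.symm, if_true,
        if_false]
      split_ifs <;> simp
    rw [this, sub_self, norm_zero]
  have := norm_run_sub_trans f hA.1 (listOn_append.2 hon.2) c1 (norm_run_sub_trans f hA.1 hon.2.2 hq c2)
  rw [hlist]
  linarith

/-- The memory `m` in the search for the element after `m₀`, when `k` bits are still missing. -/
structure Partial (X : Finset (BitString l)) (m₀ m : ℕ → Bool) (M j k : ℕ) : Prop where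
  eq_old : ∀ i < blockAt l M (j + 1), m i = m₀ i
  bits : ∀ i < k, m (blockAt l M (j + 1) + 1 + i) = false
  answers : ∀ i < k, m (blockAt l M (j + 1) + l + 2 + i) = false
  flag : m (blockAt l M (j + 1)) = false
  rest : ∀ i, blockAt l M (j + 2) ≤ i → m i = false
  lower : ∀ x ∈ remaining f X m₀ (blockAt l M j) (blockAt l M j + 1),
    val m (blockAt l M (j + 1) + 1) (l + 1) ≤ num x
  upper : val m (blockAt l M (j + 1) + 1) (l + 1) + 2 ^ k = 2 ^ (l + 1) ∨
    ∃ x ∈ remaining f X m₀ (blockAt l M j) (blockAt l M j + 1),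
      num x < val m (blockAt l M (j + 1) + 1) (l + 1) + 2 ^ k

/-- Binary search from the top bit down. With `V` the current value and `k` bits missing, no
remaining element lies below `V`, and some remaining element lies below `V + 2 ^ k` unless the
interval still reaches the end `2 ^ (l + 1)` of the range. The latter alternative covers the start
and the search in an empty set. -/
theorem exists_partial (hA : Prepares A X) (hX : X.Nonempty) {m₀ : ℕ → Bool}
    (hm₀ : Clean l M m₀) {μ e : ℕ} (hμ : X.card ≤ 9 ^ μ) (hM : M = 5 * e * (μ + 1)) {j : ℕ}
    (hw : blockAt l M (j + 2) ≤ w) (hzero : ∀ i, blockAt l M (j + 1) ≤ i → m₀ i = false) {a : ℕ}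
    (ha : a ≤ l + 1) : ∃ m, Partial f X m₀ m M j (l + 1 - a) ∧
      ‖run f A w ((List.range a).flatMap fun a => bitStep l M μ j (l - a)) (ket w m₀) - ket w m‖ ≤
        a * (2 * (1 / 2) ^ e) := by
  induction a with
  | zero =>
    have h3 : blockAt l M (j + 2) = _ := blockAt_succ l M (j + 1)
    have h0 : val m₀ (blockAt l M (j + 1) + 1) (l + 1) = 0 :=
      val_eq_zero fun i _ => hzero _ (by omega)
    refine ⟨m₀, ⟨fun _ _ => rfl, fun i _ => hzero _ (by omega), fun i _ => hzero _ (by omega),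
      hzero _ le_rfl, fun i hi => hzero i (by omega), fun x _ => by omega, .inl ?_⟩, by simp⟩
    rw [h0, zero_add, Nat.sub_zero]
  | succ a ih =>
    obtain ⟨m, hP, hn⟩ := ih (by omega)
    have h1 := regAt_le_blockAt l M j
    have h2 := blockAt_succ l M j
    have h3 : blockAt l M (j + 2) = _ := blockAt_succ l M (j + 1)
    obtain ⟨k, hk⟩ : ∃ k, k = l - a := ⟨_, rfl⟩
    rw [show l + 1 - a = k + 1 by omega] at hP
    rw [show l + 1 - (a + 1) = k by omega, List.range_succ, List.flatMap_append,
      List.flatMap_singleton, ← hk]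
    have hclean : Clean l M m := fun i hi hi' => by
      rw [hP.eq_old i (by omega)]; exact hm₀ i hi hi'
    have hrem : remaining f X m (blockAt l M j) (blockAt l M j + 1) =
        remaining f X m₀ (blockAt l M j) (blockAt l M j + 1) :=
      remaining_congr f (fun i hi => hP.eq_old _ (by omega)) (hP.eq_old _ (by omega))
    set y := blockAt l M (j + 1) + 1 with hy
    set t := blockAt l M (j + 1) + l + 2 with ht
    set S := remaining f X m₀ (blockAt l M j) (blockAt l M j + 1) with hS
    obtain ⟨v, hv⟩ : ∃ v, v = !decide (∃ x ∈ S, num x < val m y (l + 1) + 2 ^ k) := ⟨_, rfl⟩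
    have hstep := norm_bitStep_sub_le f hA hX hclean hμ hM hw (show k ≤ l by omega)
      (hP.bits k (by omega)) (hP.answers k (by omega)) (v := v)
      (by rw [hv]; congr 1; rw [decide_eq_decide, hrem])
    have hon := listOn_bitStep (l := l) (M := M) (j := j) (k := k) (P := (· < w)) μ
      (fun i _ hi => by omega) (by omega)
    have hne : ∀ i, i ≠ t + k → i ≠ y + k →
        Function.update (Function.update m (t + k) v) (y + k) v i = m i := fun i h1 h2 => by
      rw [Function.update_of_ne h2, Function.update_of_ne h1]
    have hval : val (Function.update (Function.update m (t + k) v) (y + k) v) y (l + 1) =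
        val m y (l + 1) + if v then 2 ^ k else 0 := by
      rw [val_update (by omega), val_congr (m' := m) (s' := y)]
      · intro i hi
        exact Function.update_of_ne (by omega) _ _
      · rw [Function.update_of_ne (by omega)]
        exact hP.bits k (by omega)
    refine ⟨Function.update (Function.update m (t + k) v) (y + k) v, ⟨fun i hi => ?_, fun i hi => ?_, fun i hi => ?_, ?_, fun i hi => ?_, ?_, ?_⟩, ?_⟩
    · rw [hne i (by omega) (by omega), hP.eq_old i hi]
    · rw [hne _ (by omega) (by omega), hP.bits i (by omega)]
    · rw [hne _ (by omega) (by omega), hP.answers i (by omega)]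
    · rw [hne _ (by omega) (by omega), hP.flag]
    · rw [hne _ (by omega) (by omega), hP.rest i hi]
    · intro x hx
      have := hP.lower x hx
      rw [← hy] at this ⊢
      rw [hval]
      by_cases hE : ∃ x ∈ S, num x < val m y (l + 1) + 2 ^ k
      · simp [hv, hE, this]
      · have := not_lt.1 fun h => hE ⟨x, hx, h⟩
        simpa [hv, hE] using this
    · rw [← hy, hval]
      by_cases hE : ∃ x ∈ S, num x < val m y (l + 1) + 2 ^ k
      · right
        rw [hv, decide_eq_true hE, Bool.not_true, if_neg Bool.false_ne_true, add_zero]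
        exact hE
      -- The lower half is empty, so the bit is set and the upper end of the interval does not move.
      · rw [hv, decide_eq_false hE]
        have := hP.upper
        rw [← hy, pow_succ, mul_two, ← add_assoc] at this
        simpa using this
    · refine (norm_run_sub_trans f hA.1 hon hn hstep).trans (le_of_eq ?_)
      push_cast
      ring

/-- The memory after `j` elements have been enumerated. -/
structure Enumerated (X : Finset (BitString l)) (m : ℕ → Bool) (M j : ℕ) (b : Bool) : Prop where
  clean : Clean l M m
  answer : m 0 = b
  rest : ∀ i, blockAt l M (j + 1) ≤ i → m i = false
  card : (remaining f X m (blockAt l M j) (blockAt l M j + 1)).card =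
    (X.filter fun x => f x = true).card - j
  top : 0 < j → m (blockAt l M j + 1 + l) = decide ((X.filter fun x => f x = true).card < j)

/-- With no bits missing, the value is the least remaining element, or `2 ^ (l + 1) - 1` if none
remains. Setting the flag then removes exactly this element from the later searches. After
exhaustion, the large value keeps the set empty, in accordance with truncated subtraction in `card`.
-/
theorem exists_enumerated_succ (hA : Prepares A X) (hX : X.Nonempty) {m₀ : ℕ → Bool}
    {μ e : ℕ} (hμ : X.card ≤ 9 ^ μ) (hM : M = 5 * e * (μ + 1)) {j : ℕ}
    (hw : blockAt l M (j + 2) ≤ w) {b : Bool} (hm₀ : Enumerated f X m₀ M j b) :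
    ∃ m, Enumerated f X m M (j + 1) b ∧
      ‖run f A w (round l M μ j) (ket w m₀) - ket w m‖ ≤ (l + 1) * (2 * (1 / 2) ^ e) := by
  obtain ⟨m, hP, hn⟩ := exists_partial f hA hX hm₀.clean hμ hM hw hm₀.rest (a := l + 1) le_rfl
  rw [Nat.sub_self] at hP
  have h1 := regAt_le_blockAt l M j
  have h2 := blockAt_succ l M j
  have h3 : blockAt l M (j + 2) = _ := blockAt_succ l M (j + 1)
  have h4 := le_regAt l M M
  set c := blockAt l M (j + 1) with hc
  have hne : ∀ i, i ≠ c → Function.update m c true i = m i := fun i hi =>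
    Function.update_of_ne hi _ _
  have hval : val (Function.update m c true) (c + 1) (l + 1) = val m (c + 1) (l + 1) :=
    val_congr fun i _ => hne _ (by omega)
  have hlow := hP.lower
  have hup := hP.upper
  have hcard := hm₀.card
  set S := remaining f X m₀ (blockAt l M j) (blockAt l M j + 1) with hS
  rw [← hc, pow_zero] at hup
  rw [← hc] at hlow
  have htop : m (c + 1 + l) = decide (2 ^ l ≤ val m (c + 1) (l + 1)) := by
    have := val_lt m (c + 1) l
    rw [val]
    cases hml : m (c + 1 + l)
    · simp; omega
    · simp
  have hpow : 2 ^ (l + 1) = 2 * 2 ^ l := by ring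
  have hmem : ∀ x, x ∈ remaining f X (Function.update m c true) c (c + 1) ↔
      x ∈ X ∧ f x = true ∧ val m (c + 1) (l + 1) < num x := by
    intro x
    rw [remaining, Finset.mem_filter, hval, Function.update_self]
    have : ¬ (num x < val m (c + 1) (l + 1) ∨ (num x = val m (c + 1) (l + 1) ∧ true = true)) ↔
        val m (c + 1) (l + 1) < num x := by
      simp only [and_true]
      omega
    rw [this]
  have hkey : (remaining f X (Function.update m c true) c (c + 1)).card = S.card - 1 ∧
      (2 ^ l ≤ val m (c + 1) (l + 1) ↔ S.card = 0) := by
    rcases S.eq_empty_or_nonempty with hS0 | ⟨s, hs⟩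
    · have hfull : val m (c + 1) (l + 1) + 1 = 2 ^ (l + 1) := by
        rcases hup with h | ⟨x, hx, -⟩
        · exact h
        · simp [hS0] at hx
      have hpos : 0 < 2 ^ l := by positivity
      refine ⟨?_, by simp [hS0]; omega⟩
      rw [hS0, Finset.card_empty, Nat.zero_sub, Finset.card_eq_zero, Finset.eq_empty_iff_forall_notMem]
      intro x hx
      have := num_lt x
      have := ((hmem x).1 hx).2.2
      omega
    · obtain ⟨s, hs, hsv⟩ : ∃ s ∈ S, num s = val m (c + 1) (l + 1) := by
        -- An interval ending at `2 ^ (l + 1)` is impossible here: its lower end would be at most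
        -- `num s < 2 ^ l`.
        rcases hup with h | ⟨x, hx, hx'⟩
        · have := hlow s hs
          have := num_lt s
          have hpos : 0 < 2 ^ l := by positivity
          omega
        · exact ⟨x, hx, le_antisymm (by omega) (hlow x hx)⟩
      have herase : remaining f X (Function.update m c true) c (c + 1) = S.erase s := by
        ext x
        rw [hmem, Finset.mem_erase, hS, remaining, Finset.mem_filter]
        have hs' := (Finset.mem_filter.1 hs).2.2
        constructor
        · rintro ⟨h5, h6, h7⟩
          exact ⟨by rintro rfl; omega, h5, h6, by omega⟩
        · rintro ⟨h5, h6, h7, h8⟩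
          have h9 := hlow x (Finset.mem_filter.2 ⟨h6, h7, h8⟩)
          have h10 : num x ≠ num s := fun h => h5 (num_injective h)
          exact ⟨h6, h7, by omega⟩
      have := num_lt s
      have hSpos := Finset.card_pos.2 ⟨s, hs⟩
      rw [herase, Finset.card_erase_of_mem hs]
      exact ⟨rfl, by omega⟩
  refine ⟨Function.update m c true, ⟨fun i hi hi' => ?_, ?_, fun i hi => ?_, ?_, fun _ => ?_⟩, ?_⟩
  · rw [hne i (by omega), hP.eq_old i (by omega)]
    exact hm₀.clean i hi hi'
  · rw [hne 0 (by omega), hP.eq_old 0 (by omega)]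
    exact hm₀.answer
  · have hi : blockAt l M (j + 2) ≤ i := hi
    rw [hne i (by omega)]
    exact hP.rest i hi
  · rw [← hc, hkey.1, hcard]
    omega
  · rw [← hc, hne _ (by omega), htop, decide_eq_decide, hkey.2, hcard]
    omega
  · have hon := listOn_round (l := l) (M := M) (j := j) (P := (· < w)) μ fun i _ hi => by omega
    rw [round, listOn_append, ← hc] at hon
    have c2 : ‖run f A w [.not c] (ket w m) - ket w (Function.update m c true)‖ ≤ 0 := by
      rw [ListClassical.run_ket f A (by simp [Gate.Classical]) hon.2]
      simp [Gate.act, show m c = false from hP.flag]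
    refine (norm_run_sub_trans f hA.1 hon.2 hn c2).trans (le_of_eq ?_)
    push_cast
    ring

theorem exists_enumerated (hA : Prepares A X) (hX : X.Nonempty) {μ e : ℕ} (hμ : X.card ≤ 9 ^ μ)
    (hM : M = 5 * e * (μ + 1)) {j : ℕ} (hw : blockAt l M (j + 1) ≤ w) (b : Bool) :
    ∃ m, Enumerated f X m M j b ∧
      ‖run f A w ((List.range j).flatMap (round l M μ))
        (ket w (Function.update (fun _ => false) 0 b)) - ket w m‖ ≤
          j * ((l + 1) * (2 * (1 / 2) ^ e)) := by
  have h4 := le_regAt l M M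
  induction j with
  | zero =>
    have h1 := regAt_le_blockAt l M 0
    refine ⟨Function.update (fun _ => false) 0 b, ⟨fun i hi _ => ?_, by simp, fun i hi => ?_, ?_,
      fun h => absurd h (lt_irrefl 0)⟩, by simp⟩
    · exact Function.update_of_ne (by omega) _ _
    · have := regAt_le_blockAt l M (0 + 1)
      exact Function.update_of_ne (by omega) _ _
    -- The initial bound is 0 and its flag is clear, so nothing is excluded, not even an element
    -- encoding 0.
    · rw [remaining, val_eq_zero fun i _ => Function.update_of_ne (by omega) _ _,
        Function.update_of_ne (by omega)]
      simp
  | succ j ih =>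
    have h3 : blockAt l M (j + 2) = _ := blockAt_succ l M (j + 1)
    have hw : blockAt l M (j + 2) ≤ w := hw
    obtain ⟨m, hm, hn⟩ := ih (by omega)
    obtain ⟨m', hm', hn'⟩ := exists_enumerated_succ f hA hX hμ hM hw hm
    refine ⟨m', hm', ?_⟩
    rw [List.range_succ, List.flatMap_append, List.flatMap_singleton]
    refine (norm_run_sub_trans f hA.1 (listOn_round μ fun i _ hi => by omega) hn hn').trans
      (le_of_eq ?_)
    push_cast
    ring

/-- The counting circuit. -/
def countGates (l M μ B : ℕ) : List Gate :=
  decideCount l M μ B ++ [.cnot (blockAt l M B + 1 + l) 0] ++ invList (decideCount l M μ B)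

/-- The elements and query answers of all rounds remain in memory until the final uncomputation,
which erases them once the result has been copied to wire `0`. -/
theorem norm_countGates_sub_le (hA : Prepares A X) (hX : X.Nonempty) {μ e B : ℕ}
    (hμ : X.card ≤ 9 ^ μ) (hM : M = 5 * e * (μ + 1)) (hB : 0 < B)
    (hw : blockAt l M (B + 1) ≤ w) (b : Bool) :
    ‖run f A w (countGates l M μ B) (ket w (Function.update (fun _ => false) 0 b)) -
      ket w (Function.update (fun _ => false) 0
        (xor b (decide (B ≤ (X.filter fun x => f x = true).card))))‖ ≤
      2 * (B * ((l + 1) * (2 * (1 / 2) ^ e))) := by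
  obtain ⟨m, hm, hn⟩ := exists_enumerated f hA hX hμ hM hw b
  have h1 := regAt_le_blockAt l M B
  have h2 := blockAt_succ l M B
  have h4 := le_regAt l M M
  set c := blockAt l M B + 1 + l with hc
  have hon := listOn_decideCount (l := l) (M := M) (B := B) (P := fun i => i < w ∧ i ≠ 0) μ
    fun i hi hi' => ⟨by omega, by omega⟩
  have hon' := hon
  rw [decideCount, listOn_append] at hon'
  have c2 : ‖run f A w [.not c] (ket w m) - ket w (Function.update m c
      (decide (B ≤ (X.filter fun x => f x = true).card)))‖ ≤ 0 := by
    rw [ListClassical.run_ket f A (by simp [Gate.Classical]) (hon'.2.mono fun i hi => hi.1)]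
    -- The top bit says `|G| < B`, so its negation is the answer.
    simp only [acts_cons, acts_nil, Gate.act, hc, hm.top hB, ← decide_not, not_lt]
    simp
  have hrun := norm_run_sub_trans f hA.1 (hon'.2.mono fun i hi => hi.1) hn c2
  rw [add_zero, ← hc, ← decideCount] at hrun
  have := norm_compute_copy_uncompute f hA.1 hon (fun i hi => hi.1) (h := c) (t := 0) (by omega)
    (by omega) (by simp) (by omega) (Function.update (fun _ => false) 0 b)
    (decide (B ≤ (X.filter fun x => f x = true).card))
  rw [Function.update_self, Function.update_idem] at this
  refine this.trans (mul_le_mul_of_nonneg_left ?_ zero_le_two)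
  exact (norm_errPart_le (by omega) (Function.update_self _ _ _) _).trans hrun

end

end QCount

/-! ### Primitive recursiveness and choice of parameters -/

namespace QCount

/-! ### Computability of the circuits -/

section

variable {α β γ : Type*} [Primcodable α] [Primcodable β] [Primcodable γ]

theorem primrec_self : Primrec fun a : α => a := Primrec.id

theorem primrec_fst {f : α → β × γ} (hf : Primrec f) : Primrec fun a => (f a).1 :=
  Primrec.fst.comp hf

theorem primrec_snd {f : α → β × γ} (hf : Primrec f) : Primrec fun a => (f a).2 :=
  Primrec.snd.comp hf

theorem primrec_add {f g : α → ℕ} (hf : Primrec f) (hg : Primrec g) :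
    Primrec fun a => f a + g a := Primrec.nat_add.comp hf hg

theorem primrec_sub {f g : α → ℕ} (hf : Primrec f) (hg : Primrec g) :
    Primrec fun a => f a - g a := Primrec.nat_sub.comp hf hg

theorem primrec_mul {f g : α → ℕ} (hf : Primrec f) (hg : Primrec g) :
    Primrec fun a => f a * g a := Primrec.nat_mul.comp hf hg

theorem primrec_mod {f g : α → ℕ} (hf : Primrec f) (hg : Primrec g) :
    Primrec fun a => f a % g a := Primrec.nat_mod.comp hf hg

theorem primrec_cons {f : α → β} {g : α → List β} (hf : Primrec f) (hg : Primrec g) :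
    Primrec fun a => f a :: g a := Primrec.list_cons.comp hf hg

theorem primrec_append {f g : α → List β} (hf : Primrec f) (hg : Primrec g) :
    Primrec fun a => f a ++ g a := Primrec.list_append.comp hf hg

theorem primrec_flatMap_range {n : α → ℕ} {F : α → ℕ → List β} (hn : Primrec n)
    (hF : Primrec fun p : α × ℕ => F p.1 p.2) :
    Primrec fun a => (List.range (n a)).flatMap (F a) :=
  Primrec.list_flatMap (Primrec.list_range.comp hn) hF

theorem primrec_gate {f : α → ℕ ⊕ ℕ ⊕ ℕ ⊕ (ℕ × ℕ) ⊕ (ℕ × ℕ × ℕ) ⊕ ℕ ⊕ ℕ ⊕ (ℕ × ℕ)}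
    (hf : Primrec f) : Primrec fun a => Gate.equivSum.symm (f a) :=
  (Primrec.of_equiv_symm (e := Gate.equivSum)).comp hf

theorem primrec_not {i : α → ℕ} (hi : Primrec i) : Primrec fun a => Gate.not (i a) :=
  primrec_gate (Primrec.sumInl.comp hi)

theorem primrec_had {i : α → ℕ} (hi : Primrec i) : Primrec fun a => Gate.had (i a) :=
  primrec_gate (Primrec.sumInr.comp (Primrec.sumInl.comp hi))

theorem primrec_phaseT {i : α → ℕ} (hi : Primrec i) : Primrec fun a => Gate.phaseT (i a) :=
  primrec_gate (Primrec.sumInr.comp (Primrec.sumInr.comp (Primrec.sumInl.comp hi)))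

theorem primrec_cnot {i t : α → ℕ} (hi : Primrec i) (ht : Primrec t) :
    Primrec fun a => Gate.cnot (i a) (t a) :=
  primrec_gate (Primrec.sumInr.comp (Primrec.sumInr.comp (Primrec.sumInr.comp
    (Primrec.sumInl.comp (hi.pair ht)))))

theorem primrec_toffoli {i j t : α → ℕ} (hi : Primrec i) (hj : Primrec j) (ht : Primrec t) :
    Primrec fun a => Gate.toffoli (i a) (j a) (t a) :=
  primrec_gate (Primrec.sumInr.comp (Primrec.sumInr.comp (Primrec.sumInr.comp
    (Primrec.sumInr.comp (Primrec.sumInl.comp (hi.pair (hj.pair ht)))))))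

theorem primrec_prep {s : α → ℕ} (hs : Primrec s) : Primrec fun a => Gate.prep (s a) :=
  primrec_gate (Primrec.sumInr.comp (Primrec.sumInr.comp (Primrec.sumInr.comp
    (Primrec.sumInr.comp (Primrec.sumInr.comp (Primrec.sumInl.comp hs))))))

theorem primrec_prepInv {s : α → ℕ} (hs : Primrec s) : Primrec fun a => Gate.prepInv (s a) :=
  primrec_gate (Primrec.sumInr.comp (Primrec.sumInr.comp (Primrec.sumInr.comp
    (Primrec.sumInr.comp (Primrec.sumInr.comp (Primrec.sumInr.comp (Primrec.sumInl.comp hs)))))))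

theorem primrec_test {s t : α → ℕ} (hs : Primrec s) (ht : Primrec t) :
    Primrec fun a => Gate.test (s a) (t a) :=
  primrec_gate (Primrec.sumInr.comp (Primrec.sumInr.comp (Primrec.sumInr.comp
    (Primrec.sumInr.comp (Primrec.sumInr.comp (Primrec.sumInr.comp
      (Primrec.sumInr.comp (hs.pair ht))))))))

theorem primrec_sumElim {f : α → γ} {g : β → γ} (hf : Primrec f) (hg : Primrec g) :
    Primrec (Sum.elim f g) :=
  (Primrec.sumCasesOn Primrec.id (hf.comp Primrec.snd).to₂ (hg.comp Primrec.snd).to₂).of_eq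
    fun x => by cases x <;> rfl

/-- The case distinction on gates is transported to the sum type that encodes them, where it is an
iterated `Sum.elim`. -/
theorem primrec_inv : Primrec Gate.inv := by
  have h : Primrec (Sum.elim Gate.not (Sum.elim Gate.had (Sum.elim Gate.phaseT
      (Sum.elim (fun p : ℕ × ℕ => Gate.cnot p.1 p.2)
        (Sum.elim (fun p : ℕ × ℕ × ℕ => Gate.toffoli p.1 p.2.1 p.2.2)
          (Sum.elim Gate.prepInv (Sum.elim Gate.prep
            fun p : ℕ × ℕ => Gate.test p.1 p.2))))))) := by
    apply_rules [primrec_sumElim, primrec_not, primrec_had, primrec_phaseT, primrec_cnot,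
      primrec_toffoli, primrec_prep, primrec_prepInv, primrec_test, primrec_fst, primrec_snd,
      primrec_self]
  exact (h.comp (Primrec.of_equiv (e := Gate.equivSum))).of_eq fun g => by cases g <;> rfl

theorem primrec_invList {gs : α → List Gate} (h : Primrec gs) :
    Primrec fun a => invList (gs a) :=
  Primrec.list_reverse.comp (Primrec.list_map h (primrec_inv.comp Primrec.snd).to₂)

theorem primrec_cmp {K x z u : α → ℕ} (hK : Primrec K) (hx : Primrec x) (hz : Primrec z)
    (hu : Primrec u) : Primrec fun a => cmp (K a) (x a) (z a) (u a) := by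
  refine primrec_flatMap_range hK ?_
  have hx' := hx.comp (Primrec.fst (α := α) (β := ℕ))
  have hz' := hz.comp (Primrec.fst (α := α) (β := ℕ))
  have hu' := hu.comp (Primrec.fst (α := α) (β := ℕ))
  have hk := Primrec.snd (α := α) (β := ℕ)
  unfold cmpStep
  repeat' with_reducible first
    | assumption
    | exact Primrec.const _
    | apply primrec_cons
    | apply primrec_cnot
    | apply primrec_toffoli
    | apply primrec_add

theorem primrec_zeroTest {l s : α → ℕ} (hl : Primrec l) (hs : Primrec s) :
    Primrec fun a => zeroTest (l a) (s a) := by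
  unfold zeroTest
  repeat' with_reducible first
    | assumption
    | exact Primrec.const _
    | apply primrec_cons
    | apply primrec_not
    | apply primrec_cmp
    | apply primrec_add

theorem primrec_goodTest {l s b z y : α → ℕ} (hl : Primrec l) (hs : Primrec s) (hb : Primrec b)
    (hz : Primrec z) (hy : Primrec y) :
    Primrec fun a => goodTest (l a) (s a) (b a) (z a) (y a) := by
  unfold goodTest
  repeat' with_reducible first
    | assumption
    | exact Primrec.const _
    | apply primrec_cons
    | apply primrec_append
    | apply primrec_not
    | apply primrec_cnot
    | apply primrec_toffoli
    | apply primrec_test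
    | apply primrec_cmp
    | apply primrec_add
    | apply primrec_mul

theorem primrec_flagPhase {W : α → List Gate} {h : α → ℕ} (hW : Primrec W) (hh : Primrec h) :
    Primrec fun a => flagPhase (W a) (h a) := by
  have hr := Primrec.list_reverse.comp hW
  unfold flagPhase
  repeat' with_reducible first
    | assumption
    | exact Primrec.const _
    | apply primrec_cons
    | apply primrec_append
    | apply primrec_not
    | apply primrec_had

theorem primrec_flagFail {W : α → List Gate} {h i t : α → ℕ} (hW : Primrec W) (hh : Primrec h)
    (hi : Primrec i) (ht : Primrec t) :
    Primrec fun a => flagFail (W a) (h a) (i a) (t a) := by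
  have hr := Primrec.list_reverse.comp hW
  unfold flagFail
  repeat' with_reducible first
    | assumption
    | exact Primrec.const _
    | apply primrec_cons
    | apply primrec_append
    | apply primrec_not
    | apply primrec_toffoli

theorem primrec_amplify {s i : α → ℕ} {R S : α → List Gate} (hs : Primrec s) (hR : Primrec R)
    (hS : Primrec S) (hi : Primrec i) :
    Primrec fun a => amplify (s a) (R a) (S a) (i a) := by
  -- The list of the previous level occurs three times, but only as the value passed along by
  -- primitive recursion.
  have hstep : Primrec₂ fun (a : α) (p : ℕ × List Gate) =>
      p.2 ++ (R a ++ (invList p.2 ++ (S a ++ p.2))) := by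
    change Primrec fun p : α × ℕ × List Gate =>
      p.2.2 ++ (R p.1 ++ (invList p.2.2 ++ (S p.1 ++ p.2.2)))
    apply_rules [primrec_append, primrec_invList, hR.comp, hS.comp, primrec_fst, primrec_snd,
      primrec_self]
  refine (Primrec.nat_rec' hi (primrec_cons (primrec_prep hs) (Primrec.const [])) hstep).of_eq
    fun a => ?_
  induction i a with
  | zero => rfl
  | succ n ih => simp only [amplify, ← ih]

theorem primrec_regAt {l M j : α → ℕ} (hl : Primrec l) (hM : Primrec M) (hj : Primrec j) :
    Primrec fun a => regAt (l a) (M a) (j a) := by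
  unfold regAt
  apply_rules [primrec_add, primrec_mul, Primrec.const]

theorem primrec_blockAt {l M j : α → ℕ} (hl : Primrec l) (hM : Primrec M) (hj : Primrec j) :
    Primrec fun a => blockAt (l a) (M a) (j a) := by
  unfold blockAt
  apply_rules [primrec_add, primrec_mul, primrec_regAt, Primrec.const]

theorem primrec_stage {l M μ b z y j : α → ℕ} (hl : Primrec l) (hM : Primrec M)
    (hμ : Primrec μ) (hb : Primrec b) (hz : Primrec z) (hy : Primrec y) (hj : Primrec j) :
    Primrec fun a => stage (l a) (M a) (μ a) (b a) (z a) (y a) (j a) := by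
  unfold stage
  repeat' with_reducible first
    | assumption
    | exact Primrec.const _
    | apply primrec_amplify
    | apply primrec_flagPhase
    | apply primrec_goodTest
    | apply primrec_zeroTest
    | apply primrec_regAt
    | apply primrec_add
    | apply primrec_mul
    | apply primrec_mod

theorem primrec_verdict {l M b z y K : α → ℕ} (hl : Primrec l) (hM : Primrec M)
    (hb : Primrec b) (hz : Primrec z) (hy : Primrec y) (hK : Primrec K) :
    Primrec fun a => verdict (l a) (M a) (b a) (z a) (y a) (K a) := by
  have hl' := hl.comp (Primrec.fst (α := α) (β := ℕ))
  have hM' := hM.comp (Primrec.fst (α := α) (β := ℕ))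
  have hb' := hb.comp (Primrec.fst (α := α) (β := ℕ))
  have hz' := hz.comp (Primrec.fst (α := α) (β := ℕ))
  have hy' := hy.comp (Primrec.fst (α := α) (β := ℕ))
  have hj := Primrec.snd (α := α) (β := ℕ)
  unfold verdict
  repeat' with_reducible first
    | assumption
    | exact Primrec.const _
    | apply primrec_cons
    | apply primrec_flatMap_range
    | apply primrec_not
    | apply primrec_flagFail
    | apply primrec_goodTest
    | apply primrec_regAt
    | apply primrec_add
    | apply primrec_mul

theorem primrec_core {l M μ b z y : α → ℕ} (hl : Primrec l) (hM : Primrec M)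
    (hμ : Primrec μ) (hb : Primrec b) (hz : Primrec z) (hy : Primrec y) :
    Primrec fun a => core (l a) (M a) (μ a) (b a) (z a) (y a) :=
  primrec_append
    (primrec_flatMap_range hM (primrec_stage (hl.comp Primrec.fst) (hM.comp Primrec.fst)
      (hμ.comp Primrec.fst) (hb.comp Primrec.fst) (hz.comp Primrec.fst) (hy.comp Primrec.fst)
      Primrec.snd))
    (primrec_verdict hl hM hb hz hy hM)

theorem primrec_query {l M μ b z y t : α → ℕ} (hl : Primrec l) (hM : Primrec M)
    (hμ : Primrec μ) (hb : Primrec b) (hz : Primrec z) (hy : Primrec y) (ht : Primrec t) :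
    Primrec fun a => query (l a) (M a) (μ a) (b a) (z a) (y a) (t a) := by
  have hcore := primrec_core hl hM hμ hb hz hy
  unfold query
  repeat' with_reducible first
    | assumption
    | exact Primrec.const _
    | apply primrec_cons
    | apply primrec_append
    | apply primrec_invList
    | apply primrec_cnot
    | apply primrec_add
    | apply primrec_mul

theorem primrec_bitStep {l M μ j k : α → ℕ} (hl : Primrec l) (hM : Primrec M)
    (hμ : Primrec μ) (hj : Primrec j) (hk : Primrec k) :
    Primrec fun a => bitStep (l a) (M a) (μ a) (j a) (k a) := by
  unfold bitStep
  repeat' with_reducible first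
    | assumption
    | exact Primrec.const _
    | apply primrec_cons
    | apply primrec_append
    | apply primrec_not
    | apply primrec_cnot
    | apply primrec_query
    | apply primrec_blockAt
    | apply primrec_add

theorem primrec_round {l M μ j : α → ℕ} (hl : Primrec l) (hM : Primrec M)
    (hμ : Primrec μ) (hj : Primrec j) :
    Primrec fun a => round (l a) (M a) (μ a) (j a) := by
  have hl' := hl.comp (Primrec.fst (α := α) (β := ℕ))
  have hM' := hM.comp (Primrec.fst (α := α) (β := ℕ))
  have hμ' := hμ.comp (Primrec.fst (α := α) (β := ℕ))
  have hj' := hj.comp (Primrec.fst (α := α) (β := ℕ))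
  have hk := Primrec.snd (α := α) (β := ℕ)
  unfold round
  repeat' with_reducible first
    | assumption
    | exact Primrec.const _
    | apply primrec_cons
    | apply primrec_append
    | apply primrec_flatMap_range
    | apply primrec_bitStep
    | apply primrec_not
    | apply primrec_blockAt
    | apply primrec_sub
    | apply primrec_add

theorem primrec_decideCount {l M μ B : α → ℕ} (hl : Primrec l) (hM : Primrec M)
    (hμ : Primrec μ) (hB : Primrec B) :
    Primrec fun a => decideCount (l a) (M a) (μ a) (B a) := by
  have h := primrec_round (hl.comp (Primrec.fst (α := α) (β := ℕ))) (hM.comp Primrec.fst)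
    (hμ.comp Primrec.fst) Primrec.snd
  unfold decideCount
  repeat' with_reducible first
    | assumption
    | exact Primrec.const _
    | apply primrec_cons
    | apply primrec_append
    | apply primrec_flatMap_range
    | apply primrec_not
    | apply primrec_blockAt
    | apply primrec_add

theorem primrec_countGates {l M μ B : α → ℕ} (hl : Primrec l) (hM : Primrec M)
    (hμ : Primrec μ) (hB : Primrec B) :
    Primrec fun a => countGates (l a) (M a) (μ a) (B a) := by
  have h := primrec_decideCount hl hM hμ hB
  unfold countGates
  repeat' with_reducible first
    | assumption
    | exact Primrec.const _
    | apply primrec_cons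
    | apply primrec_append
    | apply primrec_invList
    | apply primrec_cnot
    | apply primrec_blockAt
    | apply primrec_add

end

/-- The largest level of amplification for a search space of size `N`. -/
def maxLevel (l N : ℕ) : ℕ := Nat.findGreatest (fun i => 9 ^ i < 9 * N) l

/-- The number of search registers for error `2 ^ (-e)`. -/
def numRegs (l N e : ℕ) : ℕ := 5 * e * (maxLevel l N + 1)

/-- The circuit that decides whether there are at least `B` good elements in a search space of
size `N`, with error at most `2 ^ (-k n)`. -/
def countCircuit (k : ℕ) (p : ℕ × ℕ × ℕ × ℕ) : Circuit :=
  -- If `N < B`, the answer is always no, and the empty circuit is exact. Otherwise `B ≤ N ≤ 2 ^ l`,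
  -- as the error bound requires.
  if p.2.2.2 < p.2.2.1 then ⟨1, []⟩
  else ⟨blockAt p.2.1 (numRegs p.2.1 p.2.2.2 (k * p.1 + 2 * p.2.1 + 2)) (p.2.2.1 + 1),
    countGates p.2.1 (numRegs p.2.1 p.2.2.2 (k * p.1 + 2 * p.2.1 + 2))
      (maxLevel p.2.1 p.2.2.2) p.2.2.1⟩

theorem primrec_pow_nine : Primrec fun i : ℕ => 9 ^ i := by
  refine (Primrec.nat_rec₁ 1 (f := fun _ p => p * 9)
    (primrec_mul Primrec.snd (Primrec.const 9)).to₂).of_eq fun i => ?_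
  induction i with
  | zero => rfl
  | succ i ih => simp only [pow_succ, ← ih]

theorem primrec_countCircuit (k : ℕ) : Primrec (countCircuit k) := by
  have hl : Primrec fun p : ℕ × ℕ × ℕ × ℕ => p.2.1 := primrec_fst Primrec.snd
  have hB : Primrec fun p : ℕ × ℕ × ℕ × ℕ => p.2.2.1 := primrec_fst (primrec_snd Primrec.snd)
  have hN : Primrec fun p : ℕ × ℕ × ℕ × ℕ => p.2.2.2 := primrec_snd (primrec_snd Primrec.snd)
  have hn : Primrec fun p : ℕ × ℕ × ℕ × ℕ => p.1 := Primrec.fst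
  have hμ : Primrec fun p : ℕ × ℕ × ℕ × ℕ => maxLevel p.2.1 p.2.2.2 := by
    refine Primrec.nat_findGreatest hl ?_
    exact Primrec.nat_lt.comp (primrec_pow_nine.comp Primrec.snd)
      (primrec_mul (Primrec.const 9) (hN.comp Primrec.fst))
  have hM : Primrec fun p : ℕ × ℕ × ℕ × ℕ =>
      numRegs p.2.1 p.2.2.2 (k * p.1 + 2 * p.2.1 + 2) :=
    primrec_mul (primrec_mul (Primrec.const 5) (primrec_add (primrec_add
      (primrec_mul (Primrec.const k) hn) (primrec_mul (Primrec.const 2) hl)) (Primrec.const 2)))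
      (primrec_add hμ (Primrec.const 1))
  have hmk : ∀ {w : ℕ × ℕ × ℕ × ℕ → ℕ} {gs : ℕ × ℕ × ℕ × ℕ → List Gate}, Primrec w →
      Primrec gs → Primrec fun p => (⟨w p, gs p⟩ : Circuit) := fun hw hgs =>
    (Primrec.of_equiv_symm (e := Circuit.equivProd)).comp (hw.pair hgs)
  refine Primrec.ite (Primrec.nat_lt.comp hN hB) (Primrec.const _) (hmk
    (primrec_blockAt hl hM (primrec_add hB (Primrec.const 1))) (primrec_countGates hl hM hμ hB))

/-! ### Running time and error -/

theorem card_le_two_pow {l : ℕ} (X : Finset (BitString l)) : X.card ≤ 2 ^ l := by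
  simpa using Finset.card_le_univ X

theorem maxLevel_le (l N : ℕ) : maxLevel l N ≤ l := Nat.findGreatest_le l

theorem nine_pow_maxLevel_lt {l N : ℕ} (hN : 0 < N) : 9 ^ maxLevel l N < 9 * N :=
  Nat.findGreatest_spec (P := fun i => 9 ^ i < 9 * N) (Nat.zero_le l) (by simp; omega)

/-- If `9 ^ μ < N`, then `μ + 1` also satisfies the defining inequality, so maximality forces `μ =
l`; but `9 ^ l ≥ 2 ^ l ≥ N`. -/
theorem le_nine_pow_maxLevel {l N : ℕ} (hl : N ≤ 2 ^ l) : N ≤ 9 ^ maxLevel l N := by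
  by_contra! h
  have h1 : ¬ maxLevel l N + 1 ≤ l := fun h2 => by
    refine Nat.findGreatest_is_greatest (P := fun i => 9 ^ i < 9 * N) (n := l)
      (Nat.lt_succ_self (maxLevel l N)) h2 ?_
    rw [Nat.succ_eq_add_one, pow_succ]
    omega
  have h2 : maxLevel l N = l := le_antisymm (maxLevel_le l N) (by omega)
  rw [h2] at h
  have h3 : 2 ^ l ≤ 9 ^ l := Nat.pow_le_pow_left (by norm_num) l
  omega

theorem three_pow_maxLevel_le {l N : ℕ} (hN : 0 < N) : (3 : ℝ) ^ maxLevel l N ≤ 3 * √(N : ℝ) := by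
  have h : ((9 : ℝ) ^ maxLevel l N) ≤ 9 * N := by exact_mod_cast (nine_pow_maxLevel_lt hN).le
  have h2 : (3 : ℝ) ^ maxLevel l N ≤ √(9 * N) := by
    apply Real.le_sqrt_of_sq_le
    rw [← pow_mul, mul_comm, pow_mul]
    norm_num
    exact h
  rwa [Real.sqrt_mul (by norm_num), show (9 : ℝ) = 3 ^ 2 by norm_num,
    Real.sqrt_sq (by norm_num)] at h2

theorem length_countGates_le (l M μ B : ℕ) (hB : 1 ≤ B) : (countGates l M μ B).length ≤
    (2 * ((l + 1) * ((M + 1) * (160 * l + 230) + 3)) + 5) * (B * 3 ^ μ) := by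
  have h := length_decideCount_le l M μ B
  have h1 : 1 ≤ 3 ^ μ := Nat.one_le_pow _ _ (by norm_num)
  -- Writing `3 ^ μ = 1 + t` and `B = 1 + c` turns the inequality into a comparison of polynomials
  -- with non-negative variables.
  obtain ⟨t, ht⟩ := Nat.exists_eq_add_of_le h1
  obtain ⟨c, hc⟩ := Nat.exists_eq_add_of_le hB
  simp only [countGates, List.length_append, length_invList, List.length_singleton]
  refine le_trans (by omega : _ ≤ 2 * (B * ((l + 1) * ((M + 1) * 3 ^ μ * (160 * l + 230) + 3) + 1)
    + 1) + 1) ?_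
  rw [ht, hc]
  ring_nf
  nlinarith [Nat.zero_le (t * c), Nat.zero_le (l * t), Nat.zero_le (l * c), Nat.zero_le (l * t * c)]

end QCount

/-! ### Correctness, running time and error of the circuit -/

namespace QCount

/-! ### Correctness of the circuits -/

theorem answerKet_eq_ket (w : ℕ) (b : Bool) :
    answerKet w b = ket w (Function.update (fun _ => false) 0 b) := by
  unfold answerKet ket
  congr 1
  funext j
  simp [cfg, Function.update_apply]

/-- The ideal state has no amplitude on the wrong answer, so the weight there is part of the squared
distance. -/
theorem probAnswer_not_le {w : ℕ} (hw : 0 < w) (ψ : State w) (b : Bool) :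
    probAnswer ψ (!b) ≤ ‖ψ - answerKet w b‖ ^ 2 := by
  rw [probAnswer, EuclideanSpace.norm_sq_eq]
  refine Finset.sum_le_sum fun c _ => ?_
  split_ifs with h
  · have hc : c ≠ fun j : Fin w => if (j : ℕ) = 0 then b else false := by
      rintro rfl
      simp [Config.get, hw] at h
    have h0 : answerKet w b c = 0 := by rw [answerKet, PiLp.single_apply, if_neg hc]
    rw [PiLp.sub_apply, h0, sub_zero]
  · positivity

theorem countCircuit_of_lt (k n l : ℕ) {B N : ℕ} (h : N < B) :
    countCircuit k (n, l, B, N) = ⟨1, []⟩ := if_pos h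

theorem countCircuit_of_le (k n l : ℕ) {B N : ℕ} (h : B ≤ N) :
    countCircuit k (n, l, B, N) =
      ⟨blockAt l (numRegs l N (k * n + 2 * l + 2)) (B + 1),
        countGates l (numRegs l N (k * n + 2 * l + 2)) (maxLevel l N) B⟩ := if_neg h.not_gt

theorem wellFormed_countCircuit (k n l B N : ℕ) :
    (countCircuit k (n, l, B, N)).WellFormed l := by
  rcases lt_or_ge N B with h | h
  · simp [countCircuit_of_lt k n l h, Circuit.WellFormed]
  rw [countCircuit_of_le k n l h]
  set M := numRegs l N (k * n + 2 * l + 2)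
  have h1 := regAt_le_blockAt l M B
  have h2 := blockAt_succ l M B
  have h3 := le_regAt l M M
  have hon := listOn_decideCount (l := l) (M := M) (B := B) (P := (· < blockAt l M (B + 1)))
    (maxLevel l N) fun i _ hi => hi
  have hall : ListOn l (· < blockAt l M (B + 1)) (countGates l M (maxLevel l N) B) := by
    simp only [countGates, listOn_append, listOn_cons, listOn_nil, Gate.On, and_true]
    exact ⟨⟨hon, by omega, by omega, by omega⟩, hon.inv⟩
  exact ⟨show 0 < blockAt l M (B + 1) by omega, fun g hg => (hall g hg).wellFormed⟩

/-- A bound for the running time, as a polynomial in `n` if `q n` bounds the size of registers. -/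
noncomputable def timePoly (q : Polynomial ℕ) (k : ℕ) : Polynomial ℕ :=
  3 * (2 * ((q + 1) * ((5 * (Polynomial.C k * Polynomial.X + 2 * q + 2) * (q + 1) + 1) *
    (160 * q + 230) + 3)) + 5)

theorem time_countCircuit_le (q : Polynomial ℕ) (k : ℕ) {n l B N : ℕ} (hl : l ≤ q.eval n)
    (hB : 1 ≤ B) : ((countCircuit k (n, l, B, N)).time : ℝ) ≤
      (((timePoly q k).eval n : ℕ) : ℝ) * ((B : ℝ) * √(N : ℝ)) := by
  rcases lt_or_ge N B with h | h
  · rw [countCircuit_of_lt k n l h]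
    simp only [Circuit.time, List.length_nil, Nat.cast_zero]
    positivity
  rw [countCircuit_of_le k n l h]
  set e := k * n + 2 * l + 2 with he
  set c := 2 * ((l + 1) * ((numRegs l N e + 1) * (160 * l + 230) + 3)) + 5
  have hc : 3 * c ≤ (timePoly q k).eval n := by
    have hM : numRegs l N e ≤ 5 * (k * n + 2 * q.eval n + 2) * (q.eval n + 1) :=
      Nat.mul_le_mul (by omega) (Nat.succ_le_succ ((maxLevel_le l N).trans hl))
    have heval : (timePoly q k).eval n = 3 * (2 * ((q.eval n + 1) *
        ((5 * (k * n + 2 * q.eval n + 2) * (q.eval n + 1) + 1) * (160 * q.eval n + 230) + 3))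
        + 5) := by
      simp [timePoly]
    rw [heval]
    simp only [c]
    gcongr
  have hlen : ((countGates l (numRegs l N e) (maxLevel l N) B).length : ℝ) ≤
      c * (B * 3 ^ maxLevel l N) := by
    exact_mod_cast length_countGates_le l (numRegs l N e) (maxLevel l N) B hB
  refine hlen.trans ?_
  have h3 := three_pow_maxLevel_le (l := l) (N := N) (by omega)
  have hc' : (3 * c : ℝ) ≤ ((timePoly q k).eval n : ℕ) := by exact_mod_cast hc
  calc (c : ℝ) * (B * 3 ^ maxLevel l N) ≤ c * (B * (3 * √(N : ℝ))) := by gcongr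
    _ = 3 * c * (B * √(N : ℝ)) := by ring
    _ ≤ _ := by gcongr

/-- This explains `e = m + 2 l + 2`: the factors `B` and `l + 1` are at most `2 ^ l` each, and the
two remaining factors 2 come from the uncomputation inside each query and from the final one. -/
theorem error_bound {m l B : ℕ} (hB : B ≤ 2 ^ l) :
    2 * ((B : ℝ) * ((l + 1) * (2 * (1 / 2) ^ (m + 2 * l + 2)))) ≤ (1 / 2) ^ m := by
  have hB' : (B : ℝ) ≤ 2 ^ l := by exact_mod_cast hB
  have hl : (l + 1 : ℝ) ≤ 2 ^ l := by exact_mod_cast Nat.lt_two_pow_self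
  calc 2 * ((B : ℝ) * ((l + 1) * (2 * (1 / 2) ^ (m + 2 * l + 2))))
      ≤ 2 * ((2 : ℝ) ^ l * (2 ^ l * (2 * (1 / 2) ^ (m + 2 * l + 2)))) := by gcongr
    _ = (1 / 2) ^ m * (2 ^ l * (1 / 2) ^ l) ^ 2 := by ring
    _ = (1 / 2) ^ m := by rw [← mul_pow]; norm_num

theorem norm_run_countCircuit_sub_le (k n : ℕ) {l B : ℕ} {X : Finset (BitString l)}
    (hX : X.Nonempty) (hB : 1 ≤ B) {A : Matrix (BitString l) (BitString l) ℂ}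
    (f : BitString l → Bool) (hA : Prepares A X) (b : Bool) :
    ‖(countCircuit k (n, l, B, X.card)).run A f (answerKet _ b) -
      answerKet _ (xor b (decide (B ≤ (X.filter fun x => f x = true).card)))‖ ≤
      (1 / 2 : ℝ) ^ (k * n) := by
  rcases lt_or_ge X.card B with h | h
  · have hG : ¬ B ≤ (X.filter fun x => f x = true).card := fun h' =>
      (h'.trans (Finset.card_filter_le _ _)).not_gt h
    rw [countCircuit_of_lt k n l h, decide_eq_false hG]
    simp [Circuit.run]
  rw [countCircuit_of_le k n l h]
  simp only [answerKet_eq_ket]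
  exact (norm_countGates_sub_le f hA hX (le_nine_pow_maxLevel (card_le_two_pow X)) rfl hB le_rfl
    b).trans (error_bound (h.trans (card_le_two_pow X)))

end QCount

theorem mainTheorem8 (α : ℝ) (q : Polynomial ℕ) (k : ℕ) :
    ∃ (p : Polynomial ℕ) (C : ℕ × ℕ × ℕ × ℕ → QCount.Circuit), Computable C ∧
      ∀ (n l B : ℕ) (X : Finset (QCount.BitString l)),
        1 ≤ B → l ≤ q.eval n → (X.card : ℝ) = (2 : ℝ) ^ (α * (n : ℝ)) →
          (C (n, l, B, X.card)).WellFormed l ∧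
          ((C (n, l, B, X.card)).time : ℝ) ≤
            ((p.eval n : ℕ) : ℝ) * ((B : ℝ) * √(X.card : ℝ)) ∧
          ∀ (A : Matrix (QCount.BitString l) (QCount.BitString l) ℂ)
            (f : QCount.BitString l → Bool), QCount.Prepares A X →
            (∀ b : Bool,
              ‖(C (n, l, B, X.card)).run A f (QCount.answerKet _ b) -
                  QCount.answerKet _ (xor b (decide (B ≤ (X.filter fun x => f x = true).card)))‖ ≤
                (1 / 2 : ℝ) ^ (k * n)) ∧
            QCount.probAnswer ((C (n, l, B, X.card)).run A f (QCount.answerKet _ false))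
                (!decide (B ≤ (X.filter fun x => f x = true).card)) ≤
              (1 / 2 : ℝ) ^ (k * n) := by
  refine ⟨QCount.timePoly q k, QCount.countCircuit k, (QCount.primrec_countCircuit k).to_comp,
    fun n l B X hB hl hN => ?_⟩
  have hX : X.Nonempty := by
    rw [← Finset.card_pos, ← Nat.cast_pos (α := ℝ), hN]
    positivity
  have hwf := QCount.wellFormed_countCircuit k n l B X.card
  refine ⟨hwf, QCount.time_countCircuit_le q k hl hB, fun A f hA => ?_⟩
  have hrun := QCount.norm_run_countCircuit_sub_le k n hX hB f hA
  refine ⟨hrun, (QCount.probAnswer_not_le hwf.1 _ _).trans ?_⟩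
  have h := hrun false
  rw [Bool.false_xor] at h
  -- The probability is bounded by the square of the norm error, which is no larger than the bound
  -- itself because the latter is at most 1.
  refine (pow_le_pow_left₀ (norm_nonneg _) h 2).trans (pow_le_of_le_one (by positivity) ?_ two_ne_zero)
  exact pow_le_one₀ (by norm_num) (by norm_num)
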